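/- Let $G$ be a finite simple graph with $n\ge 1$ vertices and treewidth $k$, where the treewidth is the minimum, over all tree decompositions $(T,\{X_i\}_{i\in V(T)})$ of $G$, of $\max_i|X_i|-1$. Consider first-order logic with counting quantifiers in the language of adjacency and equality; here, for every integer $m$, the quantifier $\exists^m x\,\Psi$ says that there are at least $m$ vertices $x$ with property $\Psi$, and it contributes $1$ to the quantifier depth (the maximum number of nested quantifiers) irrespective of $m$. Then there is a sentence $\Phi$ of this logic that uses at most $4k+4$ variables (each of which may be quantified repeatedly), has quantifier depth less than $$2(k+1)\log_2 n+8k+9,$$ and defines $G$, that is, $\Phi$ is true on $G$ and false on every graph that is not isomorphic to $G$. -/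

import Mathlib

universe u v

/-! ### Tree decompositions and treewidth -/

/-- A tree decomposition of a graph `G`: a finite tree `T` and a family of bags indexed by the
nodes of `T` such that the bags cover all vertices, every edge lies inside some bag, and
`X_i ∩ X_j ⊆ X_l` whenever `l` lies on the path from `i` to `j` in `T`. -/
structure TreeDecomposition {V : Type u} (G : SimpleGraph V) where
  Node : Type
  [fintypeNode : Fintype Node]
  tree : SimpleGraph Node
  isTree : tree.IsTree
  bag : Node → Finset V
  vertex_covered : ∀ x : V, ∃ i, x ∈ bag i
  edge_covered : ∀ x y : V, G.Adj x y → ∃ i, x ∈ bag i ∧ y ∈ bag i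
  inter_subset : ∀ (i j l : Node) (p : tree.Walk i j), p.IsPath → l ∈ p.support →
    ∀ x : V, x ∈ bag i → x ∈ bag j → x ∈ bag l

attribute [instance] TreeDecomposition.fintypeNode

/-- The width `max_i |X_i| - 1`. (If `G` has a vertex then some bag is nonempty, so the
truncated subtraction is the true one.) -/
def TreeDecomposition.width {V : Type u} {G : SimpleGraph V} (D : TreeDecomposition G) : ℕ :=
  (Finset.univ.sup fun i : D.Node => (D.bag i).card) - 1

/-- The treewidth: the minimum width of a tree decomposition. -/
noncomputable def treewidth {V : Type u} (G : SimpleGraph V) : ℕ :=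
  sInf (Set.range fun D : TreeDecomposition G => D.width)

/-- A finite graph has a tree decomposition (with a single bag), so that the infimum in the
definition of `treewidth` is an attained minimum. -/
theorem nonempty_treeDecomposition {V : Type u} [Fintype V] (G : SimpleGraph V) :
    Nonempty (TreeDecomposition G) :=
  ⟨{ Node := Unit
     tree := ⊥
     isTree := SimpleGraph.IsTree.of_subsingleton
     bag := fun _ => Finset.univ
     vertex_covered := fun x => ⟨(), Finset.mem_univ x⟩
     edge_covered := fun x y _ => ⟨(), Finset.mem_univ x, Finset.mem_univ y⟩
     inter_subset := fun _ _ _ _ _ _ x _ _ => Finset.mem_univ x }⟩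

/-! ### First-order logic with counting quantifiers over graphs -/

/-- Formulas of first-order logic with counting quantifiers, in the language of adjacency and
equality, in which only the `s` variables `x_0, …, x_{s-1}` occur (each of them may be
quantified repeatedly). `exAtLeast m i φ` is the formula `∃^m x_i φ`. -/
inductive CountingFormula (s : ℕ) : Type
  | adj (i j : Fin s) : CountingFormula s
  | equal (i j : Fin s) : CountingFormula s
  | not (φ : CountingFormula s) : CountingFormula s
  | and (φ ψ : CountingFormula s) : CountingFormula s
  | or (φ ψ : CountingFormula s) : CountingFormula s
  | all (i : Fin s) (φ : CountingFormula s) : CountingFormula s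
  | ex (i : Fin s) (φ : CountingFormula s) : CountingFormula s
  | exAtLeast (m : ℕ) (i : Fin s) (φ : CountingFormula s) : CountingFormula s

namespace CountingFormula

/-- The maximum number of nested quantifiers; a counting quantifier contributes `1`. -/
def quantifierDepth {s : ℕ} : CountingFormula s → ℕ
  | adj _ _ => 0
  | equal _ _ => 0
  | not φ => φ.quantifierDepth
  | and φ ψ => max φ.quantifierDepth ψ.quantifierDepth
  | or φ ψ => max φ.quantifierDepth ψ.quantifierDepth
  | all _ φ => φ.quantifierDepth + 1
  | ex _ φ => φ.quantifierDepth + 1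
  | exAtLeast _ _ φ => φ.quantifierDepth + 1

/-- The (indices of the) variables with a free occurrence. -/
def freeVars {s : ℕ} : CountingFormula s → Finset (Fin s)
  | adj i j => {i, j}
  | equal i j => {i, j}
  | not φ => φ.freeVars
  | and φ ψ => φ.freeVars ∪ ψ.freeVars
  | or φ ψ => φ.freeVars ∪ ψ.freeVars
  | all i φ => φ.freeVars.erase i
  | ex i φ => φ.freeVars.erase i
  | exAtLeast _ i φ => φ.freeVars.erase i

/-- A sentence is a formula without free variables. -/
def IsSentence {s : ℕ} (φ : CountingFormula s) : Prop := φ.freeVars = ∅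

/-- Satisfaction in the graph `H` under a partial assignment of vertices to the variables.
Partial assignments are used so that sentences can be evaluated in every graph, including the
one without vertices; an atom with an unassigned variable counts as false, which never matters
if all free variables are assigned. -/
def Sat {s : ℕ} {W : Type v} (H : SimpleGraph W) :
    CountingFormula s → (Fin s → Option W) → Prop
  | adj i j, a => ∃ x y : W, a i = some x ∧ a j = some y ∧ H.Adj x y
  | equal i j, a => ∃ x y : W, a i = some x ∧ a j = some y ∧ x = y
  | not φ, a => ¬ Sat H φ a
  | and φ ψ, a => Sat H φ a ∧ Sat H ψ a
  | or φ ψ, a => Sat H φ a ∨ Sat H ψ a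
  | all i φ, a => ∀ x : W, Sat H φ (Function.update a i (some x))
  | ex i φ, a => ∃ x : W, Sat H φ (Function.update a i (some x))
  | exAtLeast m i φ, a =>
      (m : ℕ∞) ≤ {x : W | Sat H φ (Function.update a i (some x))}.encard

/-- Truth of a sentence in the graph `H`: satisfaction under the empty assignment. -/
def IsTrueIn {s : ℕ} {W : Type v} (φ : CountingFormula s) (H : SimpleGraph W) : Prop :=
  Sat H φ fun _ => none

/-- `φ` defines `G`: it is a sentence that is true on `G` and false on every graph that is not
isomorphic to `G`. -/
def Defines {s : ℕ} {V : Type u} (φ : CountingFormula s) (G : SimpleGraph V) : Prop :=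
  φ.IsSentence ∧ φ.IsTrueIn G ∧
    ∀ (W : Type v) (H : SimpleGraph W), ¬ Nonempty (G ≃g H) → ¬ φ.IsTrueIn H

end CountingFormula

/-! ### Counting formulas: invariance, isolating formulas, matching of types -/

namespace CountingFormula

variable {s : ℕ}

/-! The sentence is extracted from a winning strategy of Spoiler in the bijective pebble game. As
`V` is finite, a single formula isolates each type, and counting quantifiers force equal numbers of
realisations in two equivalent graphs; matching these gives Duplicator a bijection
(`LogicEquiv.sim`). So if Spoiler beats every graph on `V` not isomorphic to `G`, finitely many
separating sentences together with one fixing the order define `G` (`exists_defines_of_sim`).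

Spoiler keeps a connected set `C` whose boundary is pebbled, together with one vertex `z` of `C`.
`Good` means that Duplicator can survive only if `H` contains a copy of `C` attached in the same way
to the pebbles. In `Good.step` Spoiler pebbles a separator `R` of `C` and demands one more bijection
`f`. Identify the boards along `f` and let `z` be a good vertex of a piece `D` of `C \ R`. Every
twin of `z` in `G` (its image under an isomorphism of components over the pebbles) is then also a
twin in `H`. Each copy of `D` contains equally many twins, so `H` has at least as many copies of
each type of piece as `G`; both fill the same finite set, so the pieces glue to an isomorphism
(`exists_glue`). Bisecting walks keeps components from leaking out of `C` or into foreign pebbles.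

The separators are bags, and the boundary of `C` stays inside two bags `a`, `b`. Walking from `a` to
`b` in the tree, the first bag at which no large piece points to `b` leaves small pieces bordered by
that bag and one of `a`, `b`, and large pieces bordered by that bag alone (`exists_separating_bag`).
A large piece is then halved by a balanced bag. Two bags, hence `2 * (k + 1)` rounds, halve the
size, and at most three bags are pebbled at a time (`exists_good`). -/

theorem sat_congr {W : Type v} (H : SimpleGraph W) (φ : CountingFormula s)
    {a b : Fin s → Option W} (h : ∀ i ∈ φ.freeVars, a i = b i) : Sat H φ a ↔ Sat H φ b := by
  induction φ generalizing a b with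
  | adj i j =>
    simp only [freeVars, Finset.mem_insert, Finset.mem_singleton] at h
    simp only [Sat, h i (Or.inl rfl), h j (Or.inr rfl)]
  | equal i j =>
    simp only [freeVars, Finset.mem_insert, Finset.mem_singleton] at h
    simp only [Sat, h i (Or.inl rfl), h j (Or.inr rfl)]
  | not φ ih => simp only [Sat, ih h]
  | and φ ψ ih1 ih2 =>
    simp only [Sat, ih1 fun i hi => h i (Finset.mem_union_left _ hi),
      ih2 fun i hi => h i (Finset.mem_union_right _ hi)]
  | or φ ψ ih1 ih2 =>
    simp only [Sat, ih1 fun i hi => h i (Finset.mem_union_left _ hi),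
      ih2 fun i hi => h i (Finset.mem_union_right _ hi)]
  | all i φ ih | ex i φ ih | exAtLeast m i φ ih =>
    have key : ∀ x : W, Sat H φ (Function.update a i (some x)) ↔
        Sat H φ (Function.update b i (some x)) := fun x => ih fun j hj => by
      by_cases hji : j = i
      · subst hji; simp
      · simp [hji, h j (Finset.mem_erase.2 ⟨hji, hj⟩)]
    simp only [Sat, key]

theorem sat_iso {V : Type u} {W : Type v} {G : SimpleGraph V} {H : SimpleGraph W} (e : G ≃g H)
    (φ : CountingFormula s) (a : Fin s → Option V) :
    Sat G φ a ↔ Sat H φ fun i => (a i).map e := by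
  induction φ generalizing a with
  | adj i j =>
    simp only [Sat, Option.map_eq_some_iff]
    constructor
    · rintro ⟨x, y, hx, hy, h⟩
      exact ⟨e x, e y, ⟨x, hx, rfl⟩, ⟨y, hy, rfl⟩, e.map_adj_iff.2 h⟩
    · rintro ⟨_, _, ⟨x, hx, rfl⟩, ⟨y, hy, rfl⟩, h⟩
      exact ⟨x, y, hx, hy, e.map_adj_iff.1 h⟩
  | equal i j =>
    simp only [Sat, Option.map_eq_some_iff]
    constructor
    · rintro ⟨x, y, hx, hy, h⟩
      exact ⟨e x, e y, ⟨x, hx, rfl⟩, ⟨y, hy, rfl⟩, congrArg e h⟩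
    · rintro ⟨_, _, ⟨x, hx, rfl⟩, ⟨y, hy, rfl⟩, h⟩
      exact ⟨x, y, hx, hy, e.injective h⟩
  | not φ ih => simp only [Sat, ih]
  | and φ ψ ih1 ih2 => simp only [Sat, ih1, ih2]
  | or φ ψ ih1 ih2 => simp only [Sat, ih1, ih2]
  | all i φ ih | ex i φ ih | exAtLeast m i φ ih =>
    have key : ∀ x : V, Sat G φ (Function.update a i (some x)) ↔
        Sat H φ (Function.update (fun i => (a i).map e) i (some (e x))) := fun x => by
      rw [ih]
      refine iff_of_eq (congrArg _ (funext fun j => ?_))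
      by_cases hji : j = i
      · subst hji; simp
      · simp [hji]
    first
      | exact (forall_congr' key).trans
          (e.surjective.forall (p := fun y => Sat H φ (Function.update _ i (some y)))).symm
      | exact (exists_congr key).trans
          (e.surjective.exists (p := fun y => Sat H φ (Function.update _ i (some y)))).symm
      | simp only [Sat]
        rw [← e.injective.encard_image]
        refine iff_of_eq (congrArg _ (congrArg _ (Set.ext fun y => ?_)))
        obtain ⟨x, rfl⟩ := e.surjective y
        rw [e.injective.mem_set_image]
        exact key x

/-- The conjunction of `base` with all members of a list of formulas. -/
def bigAnd (base : CountingFormula s) (l : List (CountingFormula s)) : CountingFormula s :=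
  l.foldr and base

theorem sat_bigAnd {W : Type v} (H : SimpleGraph W) (base : CountingFormula s)
    (l : List (CountingFormula s)) (a : Fin s → Option W) :
    Sat H (bigAnd base l) a ↔ Sat H base a ∧ ∀ φ ∈ l, Sat H φ a := by
  induction l with
  | nil => simp [bigAnd]
  | cons φ l ih =>
    have : bigAnd base (φ :: l) = and φ (bigAnd base l) := rfl
    rw [this, Sat, ih]
    simp only [List.mem_cons, forall_eq_or_imp]
    tauto

theorem quantifierDepth_bigAnd_le {base : CountingFormula s} {l : List (CountingFormula s)}
    {d : ℕ} (hb : base.quantifierDepth ≤ d) (hl : ∀ φ ∈ l, φ.quantifierDepth ≤ d) :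
    (bigAnd base l).quantifierDepth ≤ d := by
  induction l with
  | nil => exact hb
  | cons φ l ih =>
    exact max_le (hl φ (by simp)) (ih fun ψ hψ => hl ψ (by simp [hψ]))

theorem freeVars_bigAnd_subset {base : CountingFormula s} {l : List (CountingFormula s)}
    {I : Finset (Fin s)} (hb : base.freeVars ⊆ I) (hl : ∀ φ ∈ l, φ.freeVars ⊆ I) :
    (bigAnd base l).freeVars ⊆ I := by
  induction l with
  | nil => exact hb
  | cons φ l ih =>
    exact Finset.union_subset (hl φ (by simp)) (ih fun ψ hψ => hl ψ (by simp [hψ]))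

/-- Formulas of quantifier depth at most `d` with free variables in `I`. -/
def Bounded (d : ℕ) (I : Finset (Fin s)) (φ : CountingFormula s) : Prop :=
  φ.quantifierDepth ≤ d ∧ φ.freeVars ⊆ I

/-- `(G, a)` and `(H, b)` satisfy the same formulas of depth at most `d` with free variables
in `I`. -/
def LogicEquiv {V : Type u} (G H : SimpleGraph V) (d : ℕ) (I : Finset (Fin s))
    (a b : Fin s → V) : Prop :=
  ∀ φ : CountingFormula s, Bounded d I φ →
    (Sat G φ (fun i => some (a i)) ↔ Sat H φ fun i => some (b i))

theorem some_update {V : Type u} (a : Fin s → V) (i : Fin s) (x : V) :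
    (fun j => some (Function.update a i x j)) =
      Function.update (fun j => some (a j)) i (some x) := by
  funext j
  by_cases hji : j = i
  · subst hji; simp
  · simp [hji]

/-- Finitely many states can be told apart from a given one by a single formula if they can be
told apart one at a time. -/
theorem exists_isolating {X : Type u} [Finite X] {d : ℕ} {I : Finset (Fin s)} {i : Fin s}
    (hi : i ∈ I) (S : X → CountingFormula s → Prop)
    (hequal : ∀ x, S x (equal i i)) (hnot : ∀ x φ, S x (not φ) ↔ ¬ S x φ)
    (hand : ∀ x base l, S x (bigAnd base l) ↔ S x base ∧ ∀ φ ∈ l, S x φ) (z : X) :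
    ∃ φ, Bounded d I φ ∧ ∀ x, S x φ ↔ ∀ ψ, Bounded d I ψ → (S x ψ ↔ S z ψ) := by
  classical
  have := Fintype.ofFinite X
  have hb : Bounded d I (equal i i) := ⟨by simp [quantifierDepth], by simpa [freeVars] using hi⟩
  have sep : ∀ x, ∃ ψ, Bounded d I ψ ∧ S z ψ ∧
      (S x ψ → ∀ χ, Bounded d I χ → (S x χ ↔ S z χ)) := by
    intro x
    by_cases h : ∀ χ, Bounded d I χ → (S x χ ↔ S z χ)
    · exact ⟨_, hb, hequal z, fun _ => h⟩
    · push Not at h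
      obtain ⟨χ, hχ, h⟩ := h
      by_cases hz : S z χ
      · exact ⟨χ, hχ, hz, fun hx => by tauto⟩
      · exact ⟨not χ, hχ, (hnot _ _).2 hz, fun hx => by
          have := (hnot _ _).1 hx
          tauto⟩
  choose ψ hψ hz hx using sep
  refine ⟨bigAnd (equal i i) (Finset.univ.toList.map ψ), ⟨?_, ?_⟩, fun x => ?_⟩
  · refine quantifierDepth_bigAnd_le hb.1 fun φ hφ => ?_
    obtain ⟨w, -, rfl⟩ := List.mem_map.1 hφ
    exact (hψ w).1
  · refine freeVars_bigAnd_subset hb.2 fun φ hφ => ?_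
    obtain ⟨w, -, rfl⟩ := List.mem_map.1 hφ
    exact (hψ w).2
  · rw [hand]
    constructor
    · rintro ⟨-, h⟩
      exact hx x (h _ (List.mem_map.2 ⟨x, by simp, rfl⟩))
    · intro h
      refine ⟨hequal x, fun φ hφ => ?_⟩
      obtain ⟨w, -, rfl⟩ := List.mem_map.1 hφ
      exact (h _ (hψ w)).2 (hz w)

theorem exists_equiv_of_card_fiber_eq {A B T : Type*} [Finite A] [Finite B] (f : A → T) (g : B → T)
    (h : ∀ t, Nat.card {a // f a = t} = Nat.card {b // g b = t}) :
    ∃ e : A ≃ B, ∀ a, g (e a) = f a := by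
  have e : ∀ t, {a // f a = t} ≃ {b // g b = t} := fun t => (Finite.card_eq.1 (h t)).some
  refine ⟨(Equiv.sigmaFiberEquiv f).symm.trans
    ((Equiv.sigmaCongrRight e).trans (Equiv.sigmaFiberEquiv g)), fun a => ?_⟩
  exact (e (f a) ⟨a, rfl⟩).2

/-- If `φ` isolates a type of depth `d`, then the formulas `exAtLeast m i φ` have depth `d + 1` and
do not mention `i` freely, so they force the type to be realised equally often in `G` and in `H`.
Fibres of equal size can be matched. -/
theorem LogicEquiv.exists_equiv {V : Type u} [Finite V] {G H : SimpleGraph V} {d : ℕ}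
    {I : Finset (Fin s)} {a b : Fin s → V} (h : LogicEquiv G H (d + 1) I a b) (i : Fin s) :
    ∃ f : V ≃ V, ∀ x, LogicEquiv G H d (insert i I) (Function.update a i x)
      (Function.update b i (f x)) := by
  classical
  -- The extensions in both graphs form one finite family of states, so that the same formula
  -- isolates a type on both sides.
  set S : V ⊕ V → CountingFormula s → Prop := fun w φ =>
    Sum.elim (fun x => Sat G φ fun j => some (Function.update a i x j))
      (fun y => Sat H φ fun j => some (Function.update b i y j)) w with hS
  set t : V ⊕ V → Set (CountingFormula s) :=
    fun w => {φ | Bounded d (insert i I) φ ∧ S w φ} with ht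
  have ht' : ∀ w z, t w = t z ↔ ∀ ψ, Bounded d (insert i I) ψ → (S w ψ ↔ S z ψ) := by
    intro w z
    simp only [ht, Set.ext_iff, Set.mem_ofPred_eq]
    exact forall_congr' fun ψ => by tauto
  have iso : ∀ z, ∃ φ, Bounded d (insert i I) φ ∧ ∀ w, S w φ ↔ t w = t z := by
    intro z
    obtain ⟨φ, hφ, h⟩ := exists_isolating (d := d) (Finset.mem_insert_self i I) S
      (by rintro (x | x) <;> simp [hS, Sat]) (by rintro (x | x) φ <;> simp [hS, Sat])
      (by rintro (x | x) base l <;> simp [hS, sat_bigAnd]) z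
    exact ⟨φ, hφ, fun w => by rw [h, ht']⟩
  have card : ∀ τ, Nat.card {x : V // t (Sum.inl x) = τ} = Nat.card {y : V // t (Sum.inr y) = τ} := by
    intro τ
    by_cases hτ : ∃ z, t z = τ
    · obtain ⟨z, rfl⟩ := hτ
      obtain ⟨φ, hφ, hw⟩ := iso z
      have hb : ∀ m, Bounded (d + 1) I (exAtLeast m i φ) := fun m =>
        ⟨Nat.succ_le_succ hφ.1, by
          simp only [freeVars]
          exact (Finset.erase_subset_erase _ hφ.2).trans (Finset.erase_insert_subset _ _)⟩
      have key : ∀ m : ℕ, m ≤ Nat.card {x : V // t (Sum.inl x) = t z} ↔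
          m ≤ Nat.card {y : V // t (Sum.inr y) = t z} := by
        intro m
        have := h _ (hb m)
        have h1 : ∀ x, Sat G φ (Function.update (fun j => some (a j)) i (some x)) ↔
            t (Sum.inl x) = t z := fun x => by rw [← hw, hS]; simp [some_update]
        have h2 : ∀ x, Sat H φ (Function.update (fun j => some (b j)) i (some x)) ↔
            t (Sum.inr x) = t z := fun x => by rw [← hw, hS]; simp [some_update]
        simp only [Sat, h1, h2] at this
        rw [← (Set.toFinite _).cast_ncard_eq, ← (Set.toFinite _).cast_ncard_eq] at this
        rwa [Nat.cast_le, Nat.cast_le] at this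
      exact le_antisymm ((key _).1 le_rfl) ((key _).2 le_rfl)
    · push Not at hτ
      have h1 : IsEmpty {x : V // t (Sum.inl x) = τ} := ⟨fun x => hτ _ x.2⟩
      have h2 : IsEmpty {x : V // t (Sum.inr x) = τ} := ⟨fun x => hτ _ x.2⟩
      simp
  obtain ⟨f, hf⟩ := exists_equiv_of_card_fiber_eq _ _ card
  refine ⟨f, fun x φ hφ => ?_⟩
  exact ((ht' _ _).1 (hf x).symm φ hφ)

end CountingFormula

/-! ### The bijective pebble game -/

/-- The pairs in `p` form a partial isomorphism between `G` and `H`. -/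
def IsPartialIso {V : Type u} (G H : SimpleGraph V) (p : Finset (V × V)) : Prop :=
  ∀ x ∈ p, ∀ y ∈ p, (x.1 = y.1 ↔ x.2 = y.2) ∧ (G.Adj x.1 y.1 ↔ H.Adj x.2 y.2)

/-- Duplicator survives `d` rounds of the bijective pebble game with `s` pairs of pebbles on
`G` and `H` from the position in which the pairs in `p` are pebbled. -/
def Sim {V : Type u} [DecidableEq V] (s : ℕ) (G H : SimpleGraph V) :
    ℕ → Finset (V × V) → Prop
  | 0, p => IsPartialIso G H p
  | d + 1, p => IsPartialIso G H p ∧ ∀ q ⊆ p, q.card < s →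
      ∃ f : V ≃ V, ∀ x, Sim s G H d (insert (x, f x) q)

section Sim

variable {V : Type u} [DecidableEq V] {s d : ℕ} {G H : SimpleGraph V} {p q : Finset (V × V)}

omit [DecidableEq V] in
theorem IsPartialIso.mono (h : IsPartialIso G H p) (hq : q ⊆ p) : IsPartialIso G H q :=
  fun x hx y hy => h x (hq hx) y (hq hy)

theorem Sim.isPartialIso (h : Sim s G H d p) : IsPartialIso G H p := by
  cases d with
  | zero => exact h
  | succ d => exact h.1

theorem Sim.mono (h : Sim s G H d p) (hq : q ⊆ p) : Sim s G H d q := by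
  cases d with
  | zero => exact IsPartialIso.mono h hq
  | succ d => exact ⟨h.1.mono hq, fun r hr => h.2 r (hr.trans hq)⟩

theorem Sim.pred (h : Sim s G H (d + 1) p) : Sim s G H d p := by
  induction d generalizing p with
  | zero => exact h.1
  | succ d ih =>
    refine ⟨h.1, fun q hq hs => ?_⟩
    obtain ⟨f, hf⟩ := h.2 q hq hs
    exact ⟨f, fun x => ih (hf x)⟩

theorem Sim.of_le {e : ℕ} (h : Sim s G H d p) (he : e ≤ d) : Sim s G H e p := by
  induction d with
  | zero => rwa [Nat.le_zero.1 he]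
  | succ d ih =>
    rcases he.eq_or_lt with rfl | he
    · exact h
    · exact ih h.pred (Nat.lt_succ_iff.1 he)

theorem Sim.exists_round (h : Sim s G H (d + 1) p) (hs : p.card < s) :
    ∃ f : V ≃ V, ∀ x, Sim s G H d (insert (x, f x) p) := h.2 p subset_rfl hs

theorem Sim.symm (h : Sim s G H d p) : Sim s H G d (p.image Prod.swap) := by
  have iso : ∀ {p : Finset (V × V)}, IsPartialIso G H p → IsPartialIso H G (p.image Prod.swap) := by
    intro p h x' hx' y' hy'
    obtain ⟨x, hx, rfl⟩ := Finset.mem_image.1 hx'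
    obtain ⟨y, hy, rfl⟩ := Finset.mem_image.1 hy'
    exact ⟨(h x hx y hy).1.symm, (h x hx y hy).2.symm⟩
  induction d generalizing p with
  | zero => exact iso h
  | succ d ih =>
    refine ⟨iso h.1, fun q hq hs => ?_⟩
    obtain ⟨f, hf⟩ := h.2 (q.image Prod.swap) (by
      intro x hx
      obtain ⟨y, hy, rfl⟩ := Finset.mem_image.1 hx
      obtain ⟨z, hz, rfl⟩ := Finset.mem_image.1 (hq hy)
      simpa using hz) (Finset.card_image_le.trans_lt hs)
    refine ⟨f.symm, fun x => (ih (hf (f.symm x))).mono ?_⟩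
    rw [Finset.image_insert, Finset.image_image]
    simp

/-- The game may be transported along isomorphisms of both graphs. -/
theorem Sim.map {G' H' : SimpleGraph V} (σ : G ≃g G') (τ : H ≃g H') (h : Sim s G H d p) :
    Sim s G' H' d (p.image (Prod.map σ τ)) := by
  have iso : ∀ {p : Finset (V × V)}, IsPartialIso G H p →
      IsPartialIso G' H' (p.image (Prod.map σ τ)) := by
    intro p h x' hx' y' hy'
    obtain ⟨x, hx, rfl⟩ := Finset.mem_image.1 hx'
    obtain ⟨y, hy, rfl⟩ := Finset.mem_image.1 hy'
    simpa [σ.map_adj_iff, τ.map_adj_iff] using h x hx y hy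
  induction d generalizing p with
  | zero => exact iso h
  | succ d ih =>
    refine ⟨iso h.1, fun q hq hs => ?_⟩
    obtain ⟨f, hf⟩ := h.2 (q.image (Prod.map σ.symm τ.symm)) (by
      intro x hx
      obtain ⟨y, hy, rfl⟩ := Finset.mem_image.1 hx
      obtain ⟨z, hz, rfl⟩ := Finset.mem_image.1 (hq hy)
      simpa [Prod.map] using hz) (Finset.card_image_le.trans_lt hs)
    refine ⟨(σ.symm.toEquiv.trans f).trans τ.toEquiv, fun x => (ih (hf (σ.symm x))).mono ?_⟩
    rw [Finset.image_insert, Finset.image_image]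
    intro y hy
    rcases Finset.mem_insert.1 hy with rfl | hy
    · simp
    · refine Finset.mem_insert_of_mem (Finset.mem_image.2 ⟨y, hy, ?_⟩)
      simp [Prod.map]

end Sim

/-! ### From the game to a defining sentence -/

namespace CountingFormula

variable {s : ℕ}

theorem LogicEquiv.sim {V : Type u} [DecidableEq V] [Finite V] {G H : SimpleGraph V} {d : ℕ}
    {I : Finset (Fin s)} {a b : Fin s → V} (h : LogicEquiv G H d I a b) :
    Sim s G H d (I.image fun i => (a i, b i)) := by
  have iso : ∀ {d} {I : Finset (Fin s)} {a b : Fin s → V}, LogicEquiv G H d I a b →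
      IsPartialIso G H (I.image fun i => (a i, b i)) := by
    intro d I a b h x hx y hy
    obtain ⟨i, hi, rfl⟩ := Finset.mem_image.1 hx
    obtain ⟨j, hj, rfl⟩ := Finset.mem_image.1 hy
    have hij : ({i, j} : Finset (Fin s)) ⊆ I := by
      intro k hk
      rcases Finset.mem_insert.1 hk with rfl | hk
      · exact hi
      · rwa [Finset.mem_singleton.1 hk]
    have h1 := h (equal i j) ⟨by simp [quantifierDepth], hij⟩
    have h2 := h (adj i j) ⟨by simp [quantifierDepth], hij⟩
    simp only [Sat, Option.some.injEq] at h1 h2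
    refine ⟨by simpa using h1, by simpa using h2⟩
  induction d generalizing I a b with
  | zero => exact iso h
  | succ d ih =>
    refine ⟨iso h, fun q hq hs => ?_⟩
    -- One variable per remaining pebble pair: then `J` has fewer than `s` elements and a variable
    -- is free for reuse, even if several variables denoted the same pair before.
    obtain ⟨J, hJI, hinj, rfl⟩ := Finset.exists_subset_injOn_image_eq_of_surjOn (s := (I : Set _))
      (f := fun i => (a i, b i)) q (by
        intro x hx
        obtain ⟨i, hi, rfl⟩ := Finset.mem_image.1 (hq hx)
        exact ⟨i, hi, rfl⟩)
    rw [Finset.card_image_of_injOn hinj] at hs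
    obtain ⟨i, hi⟩ : ∃ i, i ∉ J := by
      by_contra! hc
      rw [Finset.eq_univ_iff_forall.2 hc] at hs
      simp at hs
    have hJ : LogicEquiv G H (d + 1) J a b := fun φ hφ =>
      h φ ⟨hφ.1, hφ.2.trans (by exact_mod_cast hJI)⟩
    obtain ⟨f, hf⟩ := hJ.exists_equiv i
    refine ⟨f, fun x => (ih (hf x)).mono ?_⟩
    rw [Finset.image_insert]
    refine Finset.insert_subset (by simp) ?_
    intro y hy
    obtain ⟨j, hj, rfl⟩ := Finset.mem_image.1 hy
    have hji : j ≠ i := fun h => hi (h ▸ hj)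
    refine Finset.mem_insert_of_mem (Finset.mem_image.2 ⟨j, hj, ?_⟩)
    simp [hji]

/-- If Spoiler wins the `d`-round game with `s` pebbles on `G` and every non-isomorphic graph
on the same vertices, then `G` is defined by a sentence of depth `d` with `s` variables. -/
theorem exists_defines_of_sim {V : Type u} [DecidableEq V] [Fintype V] [Nonempty V]
    {G : SimpleGraph V} {d : ℕ} (hs : 0 < s) (hd : 0 < d)
    (h : ∀ H : SimpleGraph V, Sim s G H d ∅ → Nonempty (G ≃g H)) :
    ∃ φ : CountingFormula s, Defines.{u, v} φ G ∧ φ.quantifierDepth ≤ d := by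
  classical
  have := Fintype.ofFinite (SimpleGraph V)
  let a : Fin s → V := fun _ => Classical.arbitrary V
  let i : Fin s := ⟨0, hs⟩
  have sep : ∀ H : SimpleGraph V, ∃ ψ : CountingFormula s, Bounded d ∅ ψ ∧
      Sat G ψ (fun i => some (a i)) ∧
      (Sat H ψ (fun i => some (a i)) → Nonempty (G ≃g H)) := by
    intro H
    by_cases hL : LogicEquiv G H d ∅ a a
    · exact ⟨all i (equal i i), ⟨hd, by simp [freeVars]⟩, by simp [Sat],
        fun _ => h H (by simpa using hL.sim)⟩
    · unfold LogicEquiv at hL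
      push Not at hL
      obtain ⟨ψ, hψ, hL⟩ := hL
      by_cases hG : Sat G ψ fun i => some (a i)
      · exact ⟨ψ, hψ, hG, fun hH => by tauto⟩
      · exact ⟨not ψ, hψ, hG, fun hH => by
          simp only [Sat] at hH
          tauto⟩
  choose ψ hψ hG hH using sep
  let size : ℕ → CountingFormula s := fun m => exAtLeast m i (equal i i)
  have sat_size : ∀ {W : Type v} (H : SimpleGraph W) m b,
      Sat H (size m) b ↔ (m : ℕ∞) ≤ (Set.univ : Set W).encard := by
    intro W H m b
    simp only [size, Sat]
    simp
  have sat_size' : ∀ m b, Sat G (size m) b ↔ m ≤ Fintype.card V := by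
    intro m b
    simp only [size, Sat]
    simp
  -- Fixing the order makes every model, whatever its universe, isomorphic to a graph on `V`, and
  -- there are only finitely many of these to exclude.
  let base := and (size (Fintype.card V)) (not (size (Fintype.card V + 1)))
  have hbase : Bounded d ∅ base := by
    constructor
    · simpa [base, size, quantifierDepth] using Nat.succ_le_of_lt hd
    · simp [base, size, freeVars]
  let φ := bigAnd base (Finset.univ.toList.map ψ)
  have hφ : Bounded d ∅ φ := by
    constructor
    · refine quantifierDepth_bigAnd_le hbase.1 fun χ hχ => ?_
      obtain ⟨H, -, rfl⟩ := List.mem_map.1 hχ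
      exact (hψ H).1
    · refine freeVars_bigAnd_subset hbase.2 fun χ hχ => ?_
      obtain ⟨H, -, rfl⟩ := List.mem_map.1 hχ
      exact (hψ H).2
  have hsent : φ.IsSentence := Finset.subset_empty.1 hφ.2
  have free : ∀ {χ : CountingFormula s}, χ.freeVars ⊆ ∅ → ∀ H : SimpleGraph V,
      Sat H χ (fun _ => none) ↔ Sat H χ fun i => some (a i) := fun hχ H =>
    sat_congr H _ fun i hi => absurd (hχ hi) (Finset.notMem_empty i)
  refine ⟨φ, ⟨hsent, ?_, ?_⟩, hφ.1⟩
  · refine (free hφ.2 G).2 ((sat_bigAnd _ _ _ _).2 ⟨?_, fun χ hχ => ?_⟩)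
    · simp only [base, Sat, sat_size']
      simp
    · obtain ⟨H, -, rfl⟩ := List.mem_map.1 hχ
      exact hG H
  · intro W H hGH htrue
    obtain ⟨⟨hle, hlt⟩, hall⟩ := (sat_bigAnd _ _ _ _).1 htrue
    rw [sat_size] at hle
    simp only [Sat] at hlt
    rw [sat_size, not_le] at hlt
    have hcard : ENat.card W = Fintype.card V := by
      rw [Set.encard_univ] at hle hlt
      refine le_antisymm ?_ hle
      exact Order.lt_add_one_iff_of_not_isMax (by simp) |>.1 (by exact_mod_cast hlt)
    have : Finite W := ENat.card_lt_top.1 (hcard ▸ ENat.natCast_lt_top _)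
    have hcard' : Nat.card V = Nat.card W := by
      rw [ENat.card_eq_coe_natCard] at hcard
      rw [Nat.card_eq_fintype_card]
      exact_mod_cast hcard.symm
    obtain ⟨e⟩ := Finite.card_eq.1 hcard'
    have iso : H.comap e ≃g H := SimpleGraph.Iso.comap e H
    have hsat := hall _ (List.mem_map.2 ⟨H.comap e, by simp, rfl⟩)
    have hsat' : Sat (H.comap e) (ψ (H.comap e)) fun _ => none := by
      rw [sat_iso iso]
      exact hsat
    obtain ⟨j⟩ := hH _ ((free (hψ _).2 _).1 hsat')
    exact hGH ⟨j.trans iso⟩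

end CountingFormula

/-! ### Twins, counting of components, and gluing -/

section Glue

variable {V : Type u}

/-- The graph on the same vertices that retains the edges inside `U`. -/
def restr (G : SimpleGraph V) (U : Set V) : SimpleGraph V where
  Adj x y := G.Adj x y ∧ x ∈ U ∧ y ∈ U
  symm := ⟨fun _ _ h => ⟨h.1.symm, h.2.2, h.2.1⟩⟩
  loopless := ⟨fun _ h => h.1.ne rfl⟩

/-- To show that a property is inherited along a component, follow the edges. -/
theorem reachable_induction {G : SimpleGraph V} {x : V} {P : V → Prop} (hx : P x)
    (hstep : ∀ a b, G.Reachable x a → G.Adj a b → P a → P b) {y : V} (h : G.Reachable x y) :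
    P y := by
  rw [SimpleGraph.reachable_iff_reflTransGen] at h
  induction h with
  | refl => exact hx
  | tail hab hbc ih => exact hstep _ _ ((SimpleGraph.reachable_iff_reflTransGen _ _).2 hab) hbc ih

/-- The permutation `g` fixes `L` pointwise and maps the component of `x` in `G - L`
isomorphically to a component of `H - L`, including the edges to `L`. -/
def IsTwinMap (L : Set V) (G H : SimpleGraph V) (x : V) (g : V ≃ V) : Prop :=
  (∀ l ∈ L, g l = l) ∧
    ∀ a, (restr G Lᶜ).Reachable x a → ∀ b, G.Adj a b ↔ H.Adj (g a) (g b)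

/-- Some `IsTwinMap` sends `x` to `y`. -/
def Twin (L : Set V) (G H : SimpleGraph V) (x y : V) : Prop :=
  ∃ g, IsTwinMap L G H x g ∧ g x = y

variable {L : Set V} {G H K : SimpleGraph V} {x y z : V} {g : V ≃ V}

theorem mem_iff_of_fixes (h : ∀ l ∈ L, g l = l) {a : V} : g a ∈ L ↔ a ∈ L :=
  ⟨fun ha => by rwa [g.injective (h _ ha)] at ha, fun ha => by rwa [h a ha]⟩

theorem IsTwinMap.reachable (h : IsTwinMap L G H x g) {a : V}
    (ha : (restr G Lᶜ).Reachable x a) : (restr H Lᶜ).Reachable (g x) (g a) := by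
  refine reachable_induction (P := fun a => (restr H Lᶜ).Reachable (g x) (g a))
    (SimpleGraph.Reachable.refl _) (fun a b hxa hab ih => ?_) ha
  refine ih.trans (SimpleGraph.Adj.reachable ⟨(h.2 a hxa b).1 hab.1, ?_, ?_⟩)
  · exact fun hl => hab.2.1 ((mem_iff_of_fixes h.1).1 hl)
  · exact fun hl => hab.2.2 ((mem_iff_of_fixes h.1).1 hl)

theorem IsTwinMap.exists_of_reachable (h : IsTwinMap L G H x g) {w : V}
    (hw : (restr H Lᶜ).Reachable (g x) w) : ∃ a, (restr G Lᶜ).Reachable x a ∧ g a = w := by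
  refine reachable_induction (P := fun w => ∃ a, (restr G Lᶜ).Reachable x a ∧ g a = w)
    ⟨x, SimpleGraph.Reachable.refl _, rfl⟩ ?_ hw
  rintro _ w - hab ⟨a, ha, rfl⟩
  obtain ⟨b, rfl⟩ := g.surjective w
  refine ⟨b, ha.trans (SimpleGraph.Adj.reachable ⟨(h.2 a ha b).2 hab.1, ?_, ?_⟩), rfl⟩
  · exact fun hl => hab.2.1 ((mem_iff_of_fixes h.1).2 hl)
  · exact fun hl => hab.2.2 ((mem_iff_of_fixes h.1).2 hl)

theorem IsTwinMap.symm (h : IsTwinMap L G H x g) : IsTwinMap L H G (g x) g.symm := by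
  refine ⟨fun l hl => by rw [Equiv.symm_apply_eq, h.1 l hl], fun w hw b => ?_⟩
  obtain ⟨a, ha, rfl⟩ := h.exists_of_reachable hw
  rw [h.2 _ (by simpa using ha)]
  simp

theorem IsTwinMap.trans (h : IsTwinMap L G H x g) {k : V ≃ V} (hk : IsTwinMap L H K (g x) k) :
    IsTwinMap L G K x (g.trans k) :=
  ⟨fun l hl => by simp [h.1 l hl, hk.1 l hl], fun a ha b => by
    rw [h.2 a ha, hk.2 _ (h.reachable ha)]
    rfl⟩

theorem IsTwinMap.of_reachable (h : IsTwinMap L G H x g) {a : V}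
    (ha : (restr G Lᶜ).Reachable x a) : IsTwinMap L G H a g :=
  ⟨h.1, fun _ hb => h.2 _ (ha.trans hb)⟩

theorem Twin.refl (L : Set V) (G : SimpleGraph V) (x : V) : Twin L G G x x :=
  ⟨Equiv.refl V, ⟨fun _ _ => rfl, fun _ _ _ => Iff.rfl⟩, rfl⟩

theorem Twin.symm (h : Twin L G H x y) : Twin L H G y x := by
  obtain ⟨g, hg, rfl⟩ := h
  exact ⟨_, hg.symm, by simp⟩

theorem Twin.trans (h : Twin L G H x y) (h' : Twin L H K y z) : Twin L G K x z := by
  obtain ⟨g, hg, rfl⟩ := h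
  obtain ⟨k, hk, rfl⟩ := h'
  exact ⟨_, hg.trans hk, rfl⟩

/-- Two twins are exchanged by an automorphism that fixes `L`. -/
theorem Twin.exists_automorphism [Finite V] (h : Twin L G G x y) (hx : x ∉ L) :
    ∃ σ : G ≃g G, σ x = y ∧ ∀ l ∈ L, σ l = l := by
  classical
  obtain ⟨g, hg, rfl⟩ := h
  set R := (restr G Lᶜ).Reachable with hR
  have notMem : ∀ {x a}, x ∉ L → R x a → a ∉ L := fun {x a} hx ha =>
    reachable_induction (G := restr G Lᶜ) (P := fun a => a ∉ L) hx (fun _ _ _ hab _ => hab.2.2) ha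
  have hgx : g x ∉ L := fun hl => hx ((mem_iff_of_fixes hg.1).1 hl)
  have hg' := hg.symm
  have hdisj : ∀ {a}, R x a → R (g x) a → R x (g x) := fun h1 h2 => h1.trans h2.symm
  -- Swaps the components of `x` and `g x`. If they coincide, the first case takes precedence and
  -- `f` is `g` there and the identity elsewhere.
  let f : V → V := fun a => if R x a then g a else if R (g x) a then g.symm a else a
  have f1 : ∀ {a}, R x a → f a = g a := fun {a} ha => if_pos ha
  have f2 : ∀ {a}, ¬ R x a → R (g x) a → f a = g.symm a := fun {a} ha hb => by
    simp only [f]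
    rw [if_neg ha, if_pos hb]
  have f3 : ∀ {a}, ¬ R x a → ¬ R (g x) a → f a = a := fun {a} ha hb => by
    simp only [f]
    rw [if_neg ha, if_neg hb]
  have r1 : ∀ {a}, R x a → R (g x) (f a) := fun ha => by
    rw [f1 ha]
    exact hg.reachable ha
  have r2 : ∀ {a}, ¬ R x a → R (g x) a → R x (f a) := fun ha hb => by
    rw [f2 ha hb]
    simpa using hg'.reachable hb
  have hinj : Function.Injective f := by
    have aux : ∀ a b, R x a → f a = f b → a = b := by
      intro a b ha hab
      by_cases hb : R x b
      · rw [f1 ha, f1 hb] at hab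
        exact g.injective hab
      · exfalso
        have ha' := r1 ha
        rw [hab] at ha'
        by_cases hb' : R (g x) b
        · exact hb ((hdisj (r2 hb hb') ha').trans hb')
        · rw [f3 hb hb'] at ha'
          exact hb' ha'
    intro a b hab
    by_cases ha : R x a
    · exact aux a b ha hab
    by_cases hb : R x b
    · exact (aux b a hb hab.symm).symm
    by_cases ha' : R (g x) a
    · by_cases hb' : R (g x) b
      · rw [f2 ha ha', f2 hb hb'] at hab
        exact g.symm.injective hab
      · exact absurd (by rw [← f3 hb hb', ← hab]; exact r2 ha ha') hb
    · by_cases hb' : R (g x) b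
      · exact absurd (by rw [← f3 ha ha', hab]; exact r2 hb hb') ha
      · rwa [f3 ha ha', f3 hb hb'] at hab
  have fL : ∀ l ∈ L, f l = l := fun l hl =>
    f3 (fun h => notMem hx h hl) (fun h => notMem hgx h hl)
  have step : ∀ {x a b}, x ∉ L → R x a → G.Adj a b → b ∉ L → R x b := fun hx ha hab hb =>
    ha.trans (SimpleGraph.Adj.reachable ⟨hab, notMem hx ha, hb⟩)
  have e1 : ∀ a b, R x a → G.Adj a b → G.Adj (f a) (f b) := by
    intro a b ha hab
    rw [f1 ha]
    by_cases hb : b ∈ L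
    · rw [fL b hb, ← hg.1 b hb]
      exact (hg.2 a ha b).1 hab
    · rw [f1 (step hx ha hab hb)]
      exact (hg.2 a ha b).1 hab
  have e2 : ∀ a b, ¬ R x a → R (g x) a → G.Adj a b → G.Adj (f a) (f b) := by
    intro a b ha ha' hab
    rw [f2 ha ha']
    by_cases hb : b ∈ L
    · rw [fL b hb, ← hg'.1 b hb]
      exact (hg'.2 a ha' b).1 hab
    · have hb' := step hgx ha' hab hb
      rw [f2 (fun h => ha (h.trans (hb'.symm.trans ha'))) hb']
      exact (hg'.2 a ha' b).1 hab
  have hom : ∀ a b, G.Adj a b → G.Adj (f a) (f b) := by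
    intro a b hab
    by_cases ha : R x a
    · exact e1 a b ha hab
    by_cases hb : R x b
    · exact (e1 b a hb hab.symm).symm
    by_cases ha' : R (g x) a
    · exact e2 a b ha ha' hab
    by_cases hb' : R (g x) b
    · exact (e2 b a hb hb' hab.symm).symm
    rwa [f3 ha ha', f3 hb hb']
  let σ : Equiv.Perm V := Equiv.ofBijective f (Finite.injective_iff_bijective.1 hinj)
  -- The inverse of `σ` is a power of `σ`, so preserving edges in one direction is enough.
  have pow : ∀ n : ℕ, ∀ a b, G.Adj a b → G.Adj ((σ ^ n) a) ((σ ^ n) b) := by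
    intro n
    induction n with
    | zero => exact fun a b h => h
    | succ n ih =>
      intro a b h
      rw [pow_succ']
      exact hom _ _ (ih a b h)
  refine ⟨⟨σ, fun {a b} => ⟨fun h => ?_, hom a b⟩⟩, f1 (SimpleGraph.Reachable.refl _), fL⟩
  have := pow (orderOf σ - 1) _ _ h
  have hid : ∀ a, (σ ^ (orderOf σ - 1)) (σ a) = a := fun a => by
    have h1 : σ ^ (orderOf σ - 1) * σ = 1 := by
      rw [← pow_succ, Nat.sub_add_cancel (orderOf_pos σ), pow_orderOf_eq_one]
    exact DFunLike.congr_fun h1 a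
  rwa [hid, hid] at this

theorem exists_injective_of_card_fiber_le {A B T : Type*} [Finite A] [Finite B] (f : A → T)
    (g : B → T) (h : ∀ t, Nat.card {a // f a = t} ≤ Nat.card {b // g b = t}) :
    ∃ e : A → B, Function.Injective e ∧ ∀ a, g (e a) = f a := by
  classical
  have := Fintype.ofFinite A
  have := Fintype.ofFinite B
  have e : ∀ t, {a // f a = t} ↪ {b // g b = t} := fun t =>
    (Function.Embedding.nonempty_of_card_le (by
      simpa only [Nat.card_eq_fintype_card] using h t)).some
  refine ⟨fun a => e (f a) ⟨a, rfl⟩, fun a b hab => ?_, fun a => (e (f a) ⟨a, rfl⟩).2⟩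
  have hfab : f a = f b := by
    rw [← (e (f a) ⟨a, rfl⟩).2, ← (e (f b) ⟨b, rfl⟩).2]
    exact congrArg g hab
  have key : ∀ (t : T) (ha : f a = t) (hb : f b = t),
      (e t ⟨a, ha⟩ : B) = e t ⟨b, hb⟩ → a = b := fun t ha hb h => by
    have := (e t).injective (Subtype.ext h)
    exact congrArg Subtype.val this
  refine key (f a) rfl hfab.symm ?_
  have hb : ∀ t (h : f b = t), (e t ⟨b, h⟩ : B) = e (f b) ⟨b, rfl⟩ := by
    rintro t rfl
    rfl
  rw [hb]
  exact hab

/-- A representative of the component of `x`. -/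
noncomputable def componentRep (G : SimpleGraph V) (x : V) : V := (G.connectedComponentMk x).out

theorem reachable_componentRep (G : SimpleGraph V) (x : V) : G.Reachable x (componentRep G x) :=
  (SimpleGraph.ConnectedComponent.exact (Quot.out_eq (G.connectedComponentMk x))).symm

theorem componentRep_eq_iff {G : SimpleGraph V} {x y : V} :
    componentRep G x = componentRep G y ↔ G.Reachable x y :=
  ⟨fun h => (reachable_componentRep G x).trans (h ▸ (reachable_componentRep G y).symm),
    fun h => by rw [componentRep, componentRep, SimpleGraph.ConnectedComponent.sound h]⟩

theorem componentRep_componentRep (G : SimpleGraph V) (x : V) :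
    componentRep G (componentRep G x) = componentRep G x :=
  componentRep_eq_iff.2 (reachable_componentRep G x).symm

/-- The components of `x` in `G - L` and of `y` in `H - L` are isomorphic relative to `L`. -/
def ComponentEquiv (L : Set V) (G H : SimpleGraph V) (x y : V) : Prop :=
  ∃ w, (restr H Lᶜ).Reachable y w ∧ Twin L G H x w

theorem ComponentEquiv.symm (h : ComponentEquiv L G H x y) : ComponentEquiv L H G y x := by
  obtain ⟨w, hw, g, hg, rfl⟩ := h
  refine ⟨g.symm y, ?_, g.symm, hg.symm.of_reachable hw.symm, rfl⟩
  simpa using hg.symm.reachable hw.symm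

theorem ComponentEquiv.trans (h : ComponentEquiv L G H x y) (h' : ComponentEquiv L H K y z) :
    ComponentEquiv L G K x z := by
  obtain ⟨w, hw, hxw⟩ := h
  obtain ⟨w', hw', k, hk, rfl⟩ := h'
  exact ⟨k w, hw'.trans (hk.reachable hw), hxw.trans ⟨k, hk.of_reachable hw, rfl⟩⟩

/-- `ComponentEquiv` as an equivalence relation on the vertices of two graphs. -/
def componentSetoid (L : Set V) (G H : SimpleGraph V) : Setoid (Bool × V) where
  r p q := ComponentEquiv L (if p.1 then G else H) (if q.1 then G else H) p.2 q.2
  iseqv := ⟨fun p => ⟨p.2, SimpleGraph.Reachable.refl _, Twin.refl _ _ _⟩, fun h => h.symm,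
    fun h h' => h.trans h'⟩

theorem mem_of_reachable_restr {U : Set V} (hU : ∀ a ∈ U, ∀ b, G.Adj a b → b ∈ U ∨ b ∈ L)
    {a : V} (ha : a ∈ U) {b : V} (hab : (restr G Lᶜ).Reachable a b) : b ∈ U :=
  reachable_induction (G := restr G Lᶜ) (P := fun b => b ∈ U) ha
    (fun a b _ h ha => (hU a ha b h.1).resolve_right h.2.2) hab

/-- The points of `U` in a given position of their component are equidistributed over the
components of the given isomorphism type. -/
theorem card_twins [Finite V] {U : Set V}
    (hH : ∀ a ∈ U, ∀ b, H.Adj a b → b ∈ U ∨ b ∈ L) (z : V) :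
    Nat.card {x // x ∈ U ∧ Twin L G H z x} =
      Nat.card {a // (a ∈ U ∧ componentRep (restr H Lᶜ) a = a) ∧ ComponentEquiv L G H z a} *
        Nat.card {w // (restr G Lᶜ).Reachable z w ∧ Twin L G G z w} := by
  classical
  rw [← Nat.card_prod]
  have hrep := reachable_componentRep (restr H Lᶜ)
  have hch : ∀ a : {a // (a ∈ U ∧ componentRep (restr H Lᶜ) a = a) ∧ ComponentEquiv L G H z a},
      ∃ g : V ≃ V, IsTwinMap L G H z g ∧ (restr H Lᶜ).Reachable a (g z) := by
    rintro ⟨a, -, w, hw, g, hg, rfl⟩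
    exact ⟨g, hg, hw⟩
  choose g hg hga using hch
  -- A twin in `H` is determined by its component, represented by `a`, and by its preimage under the
  -- chosen map `g a` into that component.
  refine (Nat.card_congr (Equiv.ofBijective (fun p => ⟨g p.1 p.2,
    mem_of_reachable_restr hH p.1.2.1.1 ((hga p.1).trans ((hg p.1).reachable p.2.2.1)),
    p.2.2.2.trans ⟨g p.1, (hg p.1).of_reachable p.2.2.1, rfl⟩⟩) ⟨?_, ?_⟩)).symm
  · rintro ⟨a, w, hw, hzw⟩ ⟨b, w', hw', hzw'⟩ h
    have h : g a w = g b w' := congrArg Subtype.val h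
    have hab : (restr H Lᶜ).Reachable a b := by
      refine ((hga a).trans ((hg a).reachable hw)).trans ?_
      rw [h]
      exact ((hga b).trans ((hg b).reachable hw')).symm
    have : a = b := Subtype.ext (by
      rw [← a.2.1.2, ← b.2.1.2]
      exact componentRep_eq_iff.2 hab)
    subst this
    have := (g a).injective h
    subst this
    rfl
  · rintro ⟨x, hx, hzx⟩
    let a : {a // (a ∈ U ∧ componentRep (restr H Lᶜ) a = a) ∧ ComponentEquiv L G H z a} :=
      ⟨componentRep (restr H Lᶜ) x, ⟨mem_of_reachable_restr hH hx (hrep x),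
        componentRep_componentRep _ _⟩, x, (hrep x).symm, hzx⟩
    obtain ⟨w, hw, hwx⟩ := (hg a).exists_of_reachable (((hga a).symm).trans (hrep x).symm)
    refine ⟨⟨a, w, hw, ?_⟩, Subtype.ext hwx⟩
    exact hzx.trans (Twin.symm ⟨g a, (hg a).of_reachable hw, hwx⟩)

/-- If all twins of suitable representatives keep their component type in `H`, then `G` and `H`
are isomorphic on `U`. -/
theorem exists_glue [Finite V] {U : Set V} (hUL : ∀ a ∈ U, a ∉ L)
    (hG : ∀ a ∈ U, ∀ b, G.Adj a b → b ∈ U ∨ b ∈ L)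
    (hH : ∀ a ∈ U, ∀ b, H.Adj a b → b ∈ U ∨ b ∈ L)
    (htwin : ∀ x ∈ U, ∃ z, (restr G Lᶜ).Reachable x z ∧
      ∀ w ∈ U, Twin L G G z w → Twin L G H z w) :
    ∃ g : V ≃ V, (∀ v, v ∉ U → g v = v) ∧ ∀ a ∈ U, ∀ b, G.Adj a b ↔ H.Adj (g a) (g b) := by
  classical
  let A (K : SimpleGraph V) := {a // a ∈ U ∧ componentRep (restr K Lᶜ) a = a}
  let t (b : Bool) (a : A (if b then G else H)) : Quotient (componentSetoid L G H) :=
    Quotient.mk _ (b, a.1)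
  -- An inequality suffices: it yields an injection of components, hence an injective self-map of
  -- the finite set `V`, which is a permutation.
  have hcard : ∀ τ, Nat.card {a // t true a = τ} ≤ Nat.card {a // t false a = τ} := by
    intro τ
    by_cases hτ : ∃ a, t true a = τ
    · obtain ⟨a, rfl⟩ := hτ
      obtain ⟨z, hz, hw⟩ := htwin a a.2.1
      have hequiv : ∀ b (a' : A (if b then G else H)), t b a' = t true a ↔
          ComponentEquiv L G (if b then G else H) z a' := by
        intro b a'
        have haz : ComponentEquiv L G G a z := ⟨a, hz.symm, Twin.refl _ _ _⟩
        have : t b a' = t true a ↔ ComponentEquiv L (if b then G else H) G a' a := Quotient.eq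
        rw [this]
        exact ⟨fun h => (h.trans haz).symm, fun h => (haz.trans h).symm⟩
      have hcongr : ∀ b, Nat.card {a' // t b a' = t true a} =
          Nat.card {c // (c ∈ U ∧ componentRep (restr (if b then G else H) Lᶜ) c = c) ∧
            ComponentEquiv L G (if b then G else H) z c} := by
        intro b
        refine Nat.card_congr ((Equiv.subtypeEquivRight (hequiv b)).trans ?_)
        exact Equiv.subtypeSubtypeEquivSubtypeInter
          (fun c => c ∈ U ∧ componentRep (restr (if b then G else H) Lᶜ) c = c)
          (fun c => ComponentEquiv L G (if b then G else H) z c)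
      have h1 := hcongr true
      have h2 := hcongr false
      simp only [if_true] at h1
      simp only [Bool.false_eq_true, if_false] at h2
      rw [h1, h2]
      have c1 := card_twins (G := G) (H := G) hG z
      have c2 := card_twins (G := G) (H := H) hH z
      have hpos : 0 < Nat.card {w // (restr G Lᶜ).Reachable z w ∧ Twin L G G z w} := by
        have : Nonempty {w // (restr G Lᶜ).Reachable z w ∧ Twin L G G z w} :=
          ⟨⟨z, SimpleGraph.Reachable.refl _, Twin.refl _ _ _⟩⟩
        exact Nat.card_pos
      refine Nat.le_of_mul_le_mul_right ?_ hpos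
      rw [← c1, ← c2]
      exact Nat.card_le_card_of_injective
        (fun x : {x // x ∈ U ∧ Twin L G G z x} =>
          (⟨x.1, x.2.1, hw _ x.2.1 x.2.2⟩ : {x // x ∈ U ∧ Twin L G H z x}))
        (fun x y h => Subtype.ext (by simpa using h))
    · have : IsEmpty {a // t true a = τ} := ⟨fun a => hτ ⟨a.1, a.2⟩⟩
      rw [Nat.card_of_isEmpty]
      exact Nat.zero_le _
  obtain ⟨ι, hι, hιt⟩ := exists_injective_of_card_fiber_le (t true) (t false) hcard
  have hch : ∀ a : A G, ∃ g : V ≃ V, IsTwinMap L G H a g ∧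
      (restr H Lᶜ).Reachable (ι a).1 (g a) := by
    intro a
    have : ComponentEquiv L G H a.1 (ι a).1 :=
      ComponentEquiv.symm (Quotient.exact (s := componentSetoid L G H) (hιt a))
    obtain ⟨w, hw, g, hg, rfl⟩ := this
    exact ⟨g, hg, hw⟩
  choose g hg hgι using hch
  have hrep := reachable_componentRep (restr G Lᶜ)
  let c (v : V) (hv : v ∈ U) : A G := ⟨componentRep (restr G Lᶜ) v,
    mem_of_reachable_restr hG hv (hrep v), componentRep_componentRep _ _⟩
  let f : V → V := fun v => if hv : v ∈ U then g (c v hv) v else v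
  have fU : ∀ v (hv : v ∈ U), f v = g (c v hv) v := fun v hv => dif_pos hv
  have fU' : ∀ v, v ∉ U → f v = v := fun v hv => dif_neg hv
  have hf : ∀ v (hv : v ∈ U), (restr H Lᶜ).Reachable (ι (c v hv)).1 (f v) := fun v hv => by
    rw [fU v hv]
    exact (hgι _).trans ((hg _).reachable (hrep v).symm)
  have hfU : ∀ v ∈ U, f v ∈ U := fun v hv => mem_of_reachable_restr hH (ι (c v hv)).2.1 (hf v hv)
  have hsame : ∀ v (hv : v ∈ U) w (hw : w ∈ U), (restr H Lᶜ).Reachable (f v) (f w) →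
      c v hv = c w hw := by
    intro v hv w hw h
    refine hι (Subtype.ext ?_)
    rw [← (ι (c v hv)).2.2, ← (ι (c w hw)).2.2]
    exact componentRep_eq_iff.2 ((hf v hv).trans (h.trans (hf w hw).symm))
  have hinj : Function.Injective f := by
    intro v w hvw
    by_cases hv : v ∈ U <;> by_cases hw : w ∈ U
    · have := hsame v hv w hw (by rw [hvw])
      rw [fU v hv, fU w hw, this] at hvw
      exact (g _).injective hvw
    · exact absurd (by rw [← fU' w hw, ← hvw]; exact hfU v hv) hw
    · exact absurd (by rw [← fU' v hv, hvw]; exact hfU w hw) hv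
    · rwa [fU' v hv, fU' w hw] at hvw
  refine ⟨Equiv.ofBijective f (Finite.injective_iff_bijective.1 hinj), fU', fun a ha b => ?_⟩
  change G.Adj a b ↔ H.Adj (f a) (f b)
  have hga := fun b => (hg (c a ha)).2 a (hrep a).symm b
  by_cases hb : b ∈ U
  · have hadj : c a ha = c b hb → (G.Adj a b ↔ H.Adj (f a) (f b)) := fun h => by
      rw [fU a ha, fU b hb, ← h]
      exact hga b
    constructor
    · intro hab
      refine (hadj (Subtype.ext (componentRep_eq_iff.2 ?_))).1 hab
      exact SimpleGraph.Adj.reachable ⟨hab, hUL a ha, hUL b hb⟩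
    · intro hab
      refine (hadj (hsame a ha b hb ?_)).2 hab
      exact SimpleGraph.Adj.reachable ⟨hab, hUL _ (hfU a ha), hUL _ (hfU b hb)⟩
  · rw [fU' b hb]
    by_cases hbL : b ∈ L
    · rw [fU a ha, hga, (hg _).1 b hbL]
    · exact ⟨fun h => absurd (hG a ha b h) (by tauto),
        fun h => absurd (hH _ (hfU a ha) b h) (by tauto)⟩

end Glue

/-! ### Spoiler's strategy on a connected set -/

section Pieces

set_option linter.unusedSectionVars false

variable {V : Type u} [DecidableEq V]

/-- Once its midpoint is pebbled, a walk of length at most `2 ^ (t + 1)` splits into two of length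
at most `2 ^ t`, each of which needs only its own ends and `B` pebbled. Thus three pairs beyond `B`
suffice. -/
theorem Sim.exists_walk {s t : ℕ} {G H : SimpleGraph V} {B : Finset V} (hs : B.card + 3 ≤ s)
    {u v u' v' : V} (h : Sim s G H t (insert (u, u') (insert (v, v') B.diag)))
    (p : (restr G (B : Set V)ᶜ).Walk u v) (hp : p.length ≤ 2 ^ t) :
    ∃ q : (restr H (B : Set V)ᶜ).Walk u' v', q.length ≤ p.length := by
  induction t generalizing u v u' v' with
  | zero =>
    have hiso := h.isPartialIso
    have huv := hiso (u, u') (by simp) (v, v') (by simp)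
    match p, hp with
    | .nil, _ =>
      obtain rfl : u' = v' := huv.1.1 rfl
      exact ⟨.nil, by simp⟩
    | .cons hadj .nil, _ =>
      have notMem : ∀ w w', (w, w') ∈ insert (u, u') (insert (v, v') B.diag) → w ∉ B → w' ∉ B := by
        intro w w' hw hwB hw'
        have := (hiso _ hw (w', w') (by simp [hw'])).1.2 rfl
        exact hwB (by rwa [show w = w' from this])
      exact ⟨.cons ⟨huv.2.1 hadj.1, notMem u u' (by simp) hadj.2.1,
        notMem v v' (by simp) hadj.2.2⟩ .nil, le_rfl⟩
    | .cons _ (.cons _ _), hp => simp at hp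
  | succ t ih =>
    obtain ⟨f, hf⟩ := h.2 _ subset_rfl (by
      have h1 := Finset.card_insert_le (u, u') (insert (v, v') B.diag)
      have h2 := Finset.card_insert_le (v, v') B.diag
      rw [Finset.diag_card] at h2
      omega)
    set w := p.getVert (p.length / 2) with hw
    have hlen : p.length ≤ 2 * 2 ^ t := by rwa [pow_succ, mul_comm] at hp
    have l1 : (p.take (p.length / 2)).length = p.length / 2 := by
      rw [SimpleGraph.Walk.take_length]
      omega
    have l2 : (p.drop (p.length / 2)).length = p.length - p.length / 2 :=
      SimpleGraph.Walk.drop_length _ _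
    obtain ⟨q1, hq1⟩ := ih (u := u) (v := w) (u' := u') (v' := f w)
      ((hf w).mono (by
        intro x hx
        simp only [Finset.mem_insert] at hx ⊢
        tauto)) (p.take (p.length / 2)) (by omega)
    obtain ⟨q2, hq2⟩ := ih (u := w) (v := v) (u' := f w) (v' := v')
      ((hf w).mono (by
        intro x hx
        simp only [Finset.mem_insert] at hx ⊢
        tauto)) (p.drop (p.length / 2)) (by omega)
    exact ⟨q1.append q2, by rw [SimpleGraph.Walk.length_append]; omega⟩

/-- The vertices of `R` cost one round each. In the last round Duplicator commits to `f` before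
seeing `x`, so one bijection serves all `x`; it must agree with the pebbles already placed, since
Spoiler could choose a pebbled vertex again. -/
theorem Sim.exists_perm {s d : ℕ} {G H : SimpleGraph V} {S R : Finset V}
    (h : Sim s G H (d + R.card + 1) S.diag) (hs : S.card + R.card < s) :
    ∃ f : V ≃ V, (∀ v ∈ S, f v = v) ∧
      ∀ x, Sim s G H d ((insert x (S ∪ R)).image fun v => (v, f v)) := by
  have extend : ∀ (R : Finset V) (d : ℕ) (S : Finset V) (e : V → V),
      Sim s G H (d + R.card) (S.image fun v => (v, e v)) → S.card + R.card ≤ s →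
      ∃ e' : V → V, (∀ v ∈ S, e' v = e v) ∧ Sim s G H d ((S ∪ R).image fun v => (v, e' v)) := by
    intro R
    induction R using Finset.induction_on with
    | empty => exact fun d S e h _ => ⟨e, fun _ _ => rfl, by simpa using h⟩
    | insert r R hr ih =>
      intro d S e h hs
      rw [Finset.card_insert_of_notMem hr] at h hs
      by_cases hrS : r ∈ S
      · obtain ⟨e', he', h'⟩ := ih d S e (Sim.pred h) (by omega)
        refine ⟨e', he', h'.mono (Finset.image_subset_image ?_)⟩
        rw [Finset.union_insert, Finset.insert_eq_of_mem (Finset.mem_union_left _ hrS)]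
      · obtain ⟨f, hf⟩ := Sim.exists_round h (Finset.card_image_le.trans_lt (by omega))
        obtain ⟨e', he', h'⟩ := ih d (insert r S) (Function.update e r (f r)) ((hf r).mono (by
          intro x hx
          obtain ⟨v, hv, rfl⟩ := Finset.mem_image.1 hx
          rcases Finset.mem_insert.1 hv with rfl | hv
          · simp
          · have hvr : v ≠ r := ne_of_mem_of_not_mem hv hrS
            simp [hvr, hv])) (by
            rw [Finset.card_insert_of_notMem hrS]
            omega)
        refine ⟨e', fun v hv => ?_, h'.mono (Finset.image_subset_image ?_)⟩
        · rw [he' v (Finset.mem_insert_of_mem hv),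
            Function.update_of_ne (ne_of_mem_of_not_mem hv hrS)]
        · rw [Finset.union_insert, Finset.insert_union]
  obtain ⟨e, he, h'⟩ := extend R (d + 1) S id (by
    rw [show d + 1 + R.card = d + R.card + 1 by omega]
    exact h.mono (by
      intro x hx
      obtain ⟨v, hv, rfl⟩ := Finset.mem_image.1 hx
      simpa using hv)) hs.le
  obtain ⟨f, hf⟩ := Sim.exists_round h' (Finset.card_image_le.trans_lt
    ((Finset.card_union_le _ _).trans_lt hs))
  have hfe : ∀ v ∈ S ∪ R, f v = e v := fun v hv =>
    ((hf v).isPartialIso (v, f v) (by simp) (v, e v)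
      (Finset.mem_insert_of_mem (Finset.mem_image_of_mem _ hv))).1.1 rfl
  refine ⟨f, fun v hv => ?_, fun x => (hf x).mono ?_⟩
  · rw [hfe v (Finset.mem_union_left _ hv)]
    exact he v hv
  · intro y hy
    obtain ⟨v, hv, rfl⟩ := Finset.mem_image.1 hy
    rcases Finset.mem_insert.1 hv with rfl | hv
    · simp
    · exact Finset.mem_insert_of_mem (Finset.mem_image.2 ⟨v, hv, by rw [hfe v hv]⟩)

theorem exists_perm_extend [Finite V] (S : Set V) (f : V → V) (hf : Set.InjOn f S) :
    ∃ g : V ≃ V, ∀ x ∈ S, g x = f x := by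
  have := Fintype.ofFinite V
  obtain ⟨g, hg⟩ := Set.MapsTo.exists_equiv_extend_of_card_eq (t := Finset.univ) (by simp)
    (s := S) (f := f) (fun _ _ => by simp) hf
  exact ⟨g.trans (Equiv.subtypeUnivEquiv fun _ => by simp), fun x hx => hg x hx⟩

variable [Fintype V]

open Classical in
/-- The vertices outside `C` with a neighbour in `C`. -/
noncomputable def nb (G : SimpleGraph V) (C : Finset V) : Finset V :=
  Finset.univ.filter fun v => v ∉ C ∧ ∃ c ∈ C, G.Adj c v

theorem mem_nb {G : SimpleGraph V} {C : Finset V} {v : V} :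
    v ∈ nb G C ↔ v ∉ C ∧ ∃ c ∈ C, G.Adj c v := by simp [nb]

theorem mem_or_mem_nb {G : SimpleGraph V} {C : Finset V} {a b : V} (ha : a ∈ C)
    (hab : G.Adj a b) : b ∈ C ∨ b ∈ nb G C := by
  by_cases hb : b ∈ C
  · exact Or.inl hb
  · exact Or.inr (mem_nb.2 ⟨hb, a, ha, hab⟩)

/-- `C` induces a connected (or empty) subgraph. -/
def IsConn (G : SimpleGraph V) (C : Finset V) : Prop :=
  ∀ a ∈ C, ∀ b ∈ C, (restr G (C : Set V)).Reachable a b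

/-- `D` is the vertex set of a connected component of the subgraph induced by `U`. -/
structure IsPiece (G : SimpleGraph V) (U D : Finset V) : Prop where
  nonempty : D.Nonempty
  subset : D ⊆ U
  conn : IsConn G D
  closed : ∀ a ∈ D, ∀ b ∈ U, G.Adj a b → b ∈ D

theorem IsConn.exists_walk {G : SimpleGraph V} {C : Finset V} (hC : IsConn G C) {a b : V}
    (ha : a ∈ C) (hb : b ∈ C) :
    ∃ p : (restr G (C : Set V)).Walk a b, p.length < C.card := by
  obtain ⟨p, hp⟩ := (hC a ha b hb).exists_isPath
  refine ⟨p, ?_⟩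
  have hsub : p.support.toFinset ⊆ C := by
    intro x hx
    have hx := (p.takeUntil x (List.mem_toFinset.1 hx)).reachable
    exact reachable_induction (G := restr G (C : Set V)) (P := fun x => x ∈ C) ha (fun _ _ _ h _ => h.2.2) hx
  have := Finset.card_le_card hsub
  rw [List.toFinset_card_of_nodup hp.support_nodup, SimpleGraph.Walk.length_support] at this
  omega

theorem restr_le_restr_nb (G : SimpleGraph V) (C : Finset V) :
    restr G (C : Set V) ≤ restr G (nb G C : Set V)ᶜ := fun _ _ h =>
  ⟨h.1, fun h' => (mem_nb.1 h').1 h.2.1, fun h' => (mem_nb.1 h').1 h.2.2⟩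

theorem mem_of_reachable_nb {G : SimpleGraph V} {C : Finset V} {a b : V} (ha : a ∈ C)
    (h : (restr G (nb G C : Set V)ᶜ).Reachable a b) : b ∈ C :=
  reachable_induction (G := restr G (nb G C : Set V)ᶜ) (P := fun b => b ∈ C) ha
    (fun _ _ _ hab ha => (mem_or_mem_nb ha hab.1).resolve_right hab.2.2) h

theorem Sim.symm_diag {s t : ℕ} {G H : SimpleGraph V} {S : Finset V} (h : Sim s G H t S.diag) :
    Sim s H G t S.diag :=
  h.symm.mono fun x hx => by
    rw [Finset.mem_diag] at hx
    exact Finset.mem_image.2 ⟨(x.1, x.1), by simp [hx.1], Prod.ext rfl hx.2⟩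

theorem Sim.exists_walk_diag {s t : ℕ} {G H : SimpleGraph V} {S B : Finset V}
    (h : Sim s G H t S.diag) (hs : B.card + 3 ≤ s) {u v : V} (hu : u ∈ S) (hv : v ∈ S)
    (hB : B ⊆ S) (p : (restr G (B : Set V)ᶜ).Walk u v) (hp : p.length ≤ 2 ^ t) :
    ∃ q : (restr H (B : Set V)ᶜ).Walk u v, q.length ≤ p.length := by
  refine Sim.exists_walk hs (h.mono fun x hx => ?_) p hp
  rw [Finset.mem_diag]
  rcases Finset.mem_insert.1 hx with rfl | hx
  · exact ⟨hu, rfl⟩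
  rcases Finset.mem_insert.1 hx with rfl | hx
  · exact ⟨hv, rfl⟩
  · rw [Finset.mem_diag] at hx
    exact ⟨hB hx.1, hx.2⟩

/-- A walk from `z` to `c` inside `C` is copied to `H`, prolonged by the edge to `w` and copied back
to `G`, where it cannot leave `C` without meeting `nb G C`. It has at most `C.card` edges. -/
theorem mem_or_mem_nb_of_sim {s t : ℕ} {G H : SimpleGraph V} {C : Finset V} (hC : IsConn G C)
    {z : V} (hz : z ∈ C) (hs : (nb G C).card + 3 ≤ s) (ht : C.card ≤ 2 ^ t)
    (h : ∀ x, Sim s G H t (insert x (insert z (nb G C))).diag) {c w : V} (hc : c ∈ C)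
    (hcw : H.Adj c w) : w ∈ C ∨ w ∈ nb G C := by
  by_cases hw : w ∈ nb G C
  · exact Or.inr hw
  left
  obtain ⟨p, hp⟩ := hC.exists_walk hz hc
  obtain ⟨q, hq⟩ := (h c).exists_walk_diag hs (by simp) (by simp)
    (fun x hx => by simp [hx]) (p.mapLe (restr_le_restr_nb G C)) (by
      rw [SimpleGraph.Walk.length_map]
      omega)
  rw [SimpleGraph.Walk.length_map] at hq
  have hcw' : (restr H (nb G C : Set V)ᶜ).Adj c w :=
    ⟨hcw, fun h' => (mem_nb.1 h').1 hc, hw⟩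
  obtain ⟨r, -⟩ := (h w).symm_diag.exists_walk_diag hs (by simp) (by simp)
    (fun x hx => by simp [hx]) (q.concat hcw') (by
      rw [SimpleGraph.Walk.length_concat]
      omega)
  exact mem_of_reachable_nb hz r.reachable

/-- If `C` is a component of `G - nb G C`, then after pebbling `z ∈ C` and the vertices of
`nb G C`, the isomorphism type of the component of `z` is determined by the `d`-round game. -/
def Good (s d : ℕ) (G : SimpleGraph V) (C : Finset V) (z : V) : Prop :=
  ∀ H : SimpleGraph V, Sim s G H d (insert z (nb G C)).diag →
    ∃ g : V ≃ V, g z = z ∧ (∀ v ∈ nb G C, g v = v) ∧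
      ∀ a ∈ C, ∀ b, G.Adj a b ↔ H.Adj (g a) (g b)

theorem Good.of_le {s d e : ℕ} {G : SimpleGraph V} {C : Finset V} {z : V} (h : Good s d G C z)
    (hde : d ≤ e) : Good s e G C z := fun H hH => h H (hH.of_le hde)

/-- A local isomorphism avoids all pebbles that are not adjacent to the component. -/
theorem exists_isTwinMap {s d : ℕ} {G H : SimpleGraph V} {D L : Finset V} {z : V}
    (hD : IsConn G D) (hz : z ∈ D) (hnb : nb G D ⊆ L) (hDL : Disjoint D L)
    (hs : (nb G D).card + 3 ≤ s) (hd : D.card ≤ 2 ^ d) (h : Sim s G H d (insert z L).diag)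
    (hgood : Good s d G D z) :
    ∃ g : V ≃ V, g z = z ∧ (∀ v ∈ L, g v = v) ∧ ∀ a ∈ D, ∀ b, G.Adj a b ↔ H.Adj (g a) (g b) := by
  obtain ⟨g, gz, gnb, gadj⟩ := hgood H (h.mono (Finset.diag_mono
    (Finset.insert_subset_insert _ hnb)))
  have hDL' := fun a (ha : a ∈ D) => Finset.disjoint_left.1 hDL ha
  have notMem_nb : ∀ a ∈ D, g a ∉ nb G D := fun a ha h' => by
    have := g.injective (gnb _ h')
    rw [this] at h'
    exact (mem_nb.1 h').1 ha
  have notMem : ∀ a ∈ D, g a ∉ L := by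
    -- If `g a` were a pebble in `L`, a short walk in `H` from `z` to `g a` off `nb G D` could be
    -- copied back to `G`, placing `g a` in `D`.
    intro a ha hL
    obtain ⟨p, hp⟩ := hD.exists_walk hz ha
    let φ : restr G (D : Set V) →g restr H (nb G D : Set V)ᶜ :=
      ⟨g, fun {x y} hxy => ⟨(gadj x hxy.2.1 y).1 hxy.1, notMem_nb x hxy.2.1,
        notMem_nb y hxy.2.2⟩⟩
    let p' : (restr H (nb G D : Set V)ᶜ).Walk z (g a) := (p.map φ).copy gz rfl
    obtain ⟨r, -⟩ := h.symm_diag.exists_walk_diag hs (by simp) (by simp [hL])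
      (fun x hx => by simp [hnb hx]) p' (by
        rw [SimpleGraph.Walk.length_copy, SimpleGraph.Walk.length_map]
        omega)
    exact hDL' _ (mem_of_reachable_nb hz r.reachable) hL
  -- `g` may move points of `L` outside `nb G D`. Only its values on `D` are kept; `L` is fixed.
  obtain ⟨k, hk⟩ := exists_perm_extend (↑(D ∪ L) : Set V) (fun v => if v ∈ D then g v else v) (by
    intro v hv w hw hvw
    have hv := Finset.mem_union.1 (Finset.mem_coe.1 hv)
    have hw := Finset.mem_union.1 (Finset.mem_coe.1 hw)
    by_cases hvD : v ∈ D <;> by_cases hwD : w ∈ D <;> simp only [hvD, hwD, if_true, if_false] at hvw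
    · exact g.injective hvw
    · exact absurd (hvw ▸ hw.resolve_left hwD) (notMem v hvD)
    · exact absurd (hvw ▸ hv.resolve_left hvD) (notMem w hwD)
    · exact hvw)
  have kD : ∀ v ∈ D, k v = g v := fun v hv => by
    rw [hk v (by simp [hv])]
    simp [hv]
  have kL : ∀ v ∈ L, k v = v := fun v hv => by
    rw [hk v (by simp [hv])]
    simp [Finset.disjoint_right.1 hDL hv]
  refine ⟨k, by rw [kD z hz, gz], kL, fun a ha b => ?_⟩
  rw [kD a ha]
  by_cases hbD : b ∈ D
  · rw [kD b hbD]
    exact gadj a ha b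
  by_cases hbnb : b ∈ nb G D
  · rw [kL b (hnb hbnb), gadj a ha b, gnb b hbnb]
  refine ⟨fun h => absurd (mem_or_mem_nb ha h) (by tauto), fun h => ?_⟩
  exfalso
  obtain ⟨c, hc⟩ := g.surjective (k b)
  rw [← hc, ← gadj a ha c] at h
  rcases mem_or_mem_nb ha h with hcD | hcnb
  · rw [← kD c hcD] at hc
    exact hbD (k.injective hc ▸ hcD)
  · rw [gnb c hcnb, ← kL c (hnb hcnb)] at hc
    exact hbnb (k.injective hc ▸ hcnb)

/-- A good vertex `z` of a component serves as its marker: an automorphism of `G` moves any twin `w`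
back to `z`, so the game with `w` pebbled supplies the copy in `H` that the twin count of
`exists_glue` needs. -/
theorem exists_glue_of_sim {s d : ℕ} {G H : SimpleGraph V} {U L : Finset V} (hUL : Disjoint U L)
    (hG : ∀ a ∈ U, ∀ b, G.Adj a b → b ∈ U ∨ b ∈ L)
    (hH : ∀ a ∈ U, ∀ b, H.Adj a b → b ∈ U ∨ b ∈ L)
    (hsim : ∀ x, Sim s G H d (insert x L).diag)
    (hD : ∀ D, IsPiece G U D →
      (nb G D).card + 3 ≤ s ∧ D.card ≤ 2 ^ d ∧ ∃ z ∈ D, Good s d G D z) :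
    ∃ g : V ≃ V, (∀ v, v ∉ U → g v = v) ∧ ∀ a ∈ U, ∀ b, G.Adj a b ↔ H.Adj (g a) (g b) := by
  classical
  refine exists_glue (L := (L : Set V)) (U := (U : Set V))
    (fun a ha => Finset.disjoint_left.1 hUL ha) hG hH fun x hx => ?_
  let D : Finset V := Finset.univ.filter fun a => (restr G (L : Set V)ᶜ).Reachable x a
  have memD : ∀ {a}, a ∈ D ↔ (restr G (L : Set V)ᶜ).Reachable x a := by simp [D]
  have hDU : D ⊆ U := fun a ha => mem_of_reachable_restr (U := (U : Set V)) hG hx (memD.1 ha)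
  have hDL : Disjoint D L := Finset.disjoint_of_subset_left hDU hUL
  have hstep : ∀ {a b}, a ∈ D → G.Adj a b → b ∉ L → b ∈ D := fun {a b} ha hab hb =>
    memD.2 ((memD.1 ha).trans
      (SimpleGraph.Adj.reachable ⟨hab, Finset.disjoint_left.1 hDL ha, hb⟩))
  have hxD : x ∈ D := memD.2 (SimpleGraph.Reachable.refl _)
  have hconn : ∀ a ∈ D, (restr G (D : Set V)).Reachable x a := fun a ha =>
    reachable_induction (G := restr G (L : Set V)ᶜ)
      (P := fun a => (restr G (D : Set V)).Reachable x a)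
      (SimpleGraph.Reachable.refl _) (fun a b hxa hab ih => ih.trans (SimpleGraph.Adj.reachable
        ⟨hab.1, memD.2 hxa, hstep (memD.2 hxa) hab.1 hab.2.2⟩)) (memD.1 ha)
  have hpiece : IsPiece G U D := ⟨⟨x, hxD⟩, hDU,
    fun a ha b hb => (hconn a ha).symm.trans (hconn b hb),
    fun a ha b hb hab => hstep ha hab (Finset.disjoint_left.1 hUL hb)⟩
  obtain ⟨hs, hd, z, hz, hgood⟩ := hD D hpiece
  refine ⟨z, memD.1 hz, fun w hw htw => ?_⟩
  have hnb : nb G D ⊆ L := fun v hv => by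
    obtain ⟨hvD, c, hc, hcv⟩ := mem_nb.1 hv
    by_contra hvL
    exact hvD (hstep hc hcv hvL)
  obtain ⟨σ, hσz, hσL⟩ := htw.exists_automorphism (Finset.disjoint_left.1 hDL hz)
  let τ : H.comap σ ≃g H := SimpleGraph.Iso.comap σ.toEquiv H
  -- Renaming both boards by the inverse of `σ` turns the pebble on `w` into one on `z`; the graph
  -- `G` is unchanged.
  have hsim' : Sim s G (H.comap σ) d (insert z L).diag := by
    refine ((hsim w).map σ.symm τ.symm).mono fun y hy => ?_
    rw [Finset.mem_diag] at hy
    refine Finset.mem_image.2 ⟨(σ y.1, σ y.1), ?_, Prod.ext (σ.symm_apply_apply _) ?_⟩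
    · rw [Finset.mem_diag]
      refine ⟨?_, rfl⟩
      rcases Finset.mem_insert.1 hy.1 with h | h
      · simp [h, hσz]
      · simp [hσL _ h, h]
    · exact (τ.symm_apply_apply y.1).trans hy.2
  obtain ⟨g, gz, gL, gadj⟩ := exists_isTwinMap hpiece.conn hz hnb hDL hs hd hsim' hgood
  refine ⟨g.trans σ.toEquiv, ⟨fun l hl => ?_, fun a ha b => ?_⟩, ?_⟩
  · exact (congrArg σ (gL l hl)).trans (hσL l hl)
  · exact gadj a (memD.2 ((memD.1 hz).trans ha)) b
  · exact (congrArg σ gz).trans hσz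

theorem Sim.comap {s d : ℕ} {G H : SimpleGraph V} {S : Finset V} {f : V ≃ V}
    (h : Sim s G H d (S.image fun v => (v, f v))) : Sim s G (H.comap f) d S.diag := by
  let τ : H.comap f ≃g H := SimpleGraph.Iso.comap f H
  refine (h.map (SimpleGraph.Iso.refl) τ.symm).mono fun y hy => ?_
  rw [Finset.mem_diag] at hy
  refine Finset.mem_image.2 ⟨(y.1, f y.1), Finset.mem_image_of_mem _ hy.1, Prod.ext rfl ?_⟩
  exact (τ.symm_apply_apply y.1).trans hy.2

/-- To win on a component, Spoiler pebbles the separator `R` and proceeds to one of the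
components of `C \ R`. -/
theorem Good.step {s d : ℕ} {G : SimpleGraph V} {C R : Finset V} {z : V} (hC : IsConn G C)
    (hz : z ∈ R) (hR : R ⊆ C) (hsR : (nb G C).card + R.card < s) (hs : (nb G C).card + 3 ≤ s)
    (hd : C.card ≤ 2 ^ d)
    (hD : ∀ D, IsPiece G (C \ R) D → (nb G D).card + 3 ≤ s ∧ ∃ z ∈ D, Good s d G D z) :
    Good s (d + R.card) G C z := by
  intro H h
  have hcard := Finset.card_erase_add_one hz
  have hcS := Finset.card_insert_le z (nb G C)
  -- As `z` is already pebbled, `R` costs `R.card - 1` rounds; the remaining one is spent on the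
  -- bijection `f`.
  rw [← hcard, ← add_assoc] at h
  obtain ⟨f, hf, hsim⟩ := h.exists_perm (by omega)
  have hL : insert z (nb G C) ∪ R.erase z = nb G C ∪ R := by
    rw [← Finset.insert_erase hz, Finset.erase_insert_eq_erase, Finset.erase_idem,
      Finset.insert_union, Finset.union_insert]
  rw [hL] at hsim
  -- After pulling `H` back along `f`, Duplicator's replies are the identity.
  have hsim2 : ∀ x, Sim s G (H.comap f) d (insert x (nb G C ∪ R)).diag := fun x => (hsim x).comap
  have hclosed : ∀ c ∈ C, ∀ w, (H.comap f).Adj c w → w ∈ C ∨ w ∈ nb G C := fun c hc w hcw =>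
    mem_or_mem_nb_of_sim hC (hR hz) hs hd (fun x => (hsim2 x).mono (Finset.diag_mono
      (Finset.insert_subset_insert _ (Finset.insert_subset (Finset.mem_union_right _ hz)
        Finset.subset_union_left)))) hc hcw
  have hdisj : ∀ {v}, v ∈ nb G C → v ∉ C := fun h => (mem_nb.1 h).1
  have split : ∀ {w}, w ∈ C ∨ w ∈ nb G C → w ∈ C \ R ∨ w ∈ nb G C ∪ R := fun {w} h => by
    rw [Finset.mem_sdiff, Finset.mem_union]
    tauto
  obtain ⟨g, gU, gadj⟩ := exists_glue_of_sim (U := C \ R) (L := nb G C ∪ R) (by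
      rw [Finset.disjoint_left]
      intro a ha hb
      rw [Finset.mem_sdiff] at ha
      rcases Finset.mem_union.1 hb with hb | hb
      · exact hdisj hb ha.1
      · exact ha.2 hb)
    (fun a ha b hab => split (mem_or_mem_nb (Finset.mem_sdiff.1 ha).1 hab))
    (fun a ha b hab => split (hclosed a (Finset.mem_sdiff.1 ha).1 b hab)) hsim2
    (fun D hp => ⟨(hD D hp).1,
      (Finset.card_le_card (hp.subset.trans Finset.sdiff_subset)).trans hd, (hD D hp).2⟩)
  have gR : ∀ v ∈ R, g v = v := fun v hv => gU v fun h => (Finset.mem_sdiff.1 h).2 hv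
  refine ⟨g.trans f, ?_, fun v hv => ?_, fun a ha b => ?_⟩
  · rw [Equiv.trans_apply, gR z hz, hf z (by simp)]
  · rw [Equiv.trans_apply, gU v fun h => hdisj hv (Finset.mem_sdiff.1 h).1, hf v (by simp [hv])]
  · change G.Adj a b ↔ (H.comap f).Adj (g a) (g b)
    by_cases haR : a ∈ R
    · by_cases hbU : b ∈ C \ R
      · rw [G.adj_comm a b, (H.comap f).adj_comm (g a) (g b)]
        exact gadj b hbU a
      rw [gR a haR, gU b hbU]
      by_cases hb : b ∈ C ∨ b ∈ nb G C
      · have hbL := (split hb).resolve_left hbU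
        exact ((hsim2 a).isPartialIso (a, a) (by simp) (b, b) (by simp [Finset.mem_union.1 hbL])).2
      · exact ⟨fun h => absurd (mem_or_mem_nb ha h) hb, fun h => absurd (hclosed a ha b h) hb⟩
    · exact gadj a (Finset.mem_sdiff.2 ⟨ha, haR⟩) b

theorem nonempty_iso_of_sim {s d : ℕ} {G H : SimpleGraph V} (hs : 0 < s)
    (h : Sim s G H (d + 1) ∅) (hd : Fintype.card V ≤ 2 ^ d)
    (hD : ∀ D, IsPiece G Finset.univ D → (nb G D).card + 3 ≤ s ∧ ∃ z ∈ D, Good s d G D z) :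
    Nonempty (G ≃g H) := by
  obtain ⟨f, -, hsim⟩ := Sim.exists_perm (S := ∅) (R := ∅) (by simpa using h) (by simpa using hs)
  rw [Finset.empty_union] at hsim
  obtain ⟨g, -, gadj⟩ := exists_glue_of_sim (U := Finset.univ) (L := ∅) (by simp)
    (by simp) (by simp) (fun x => (hsim x).comap)
    (fun D hp => ⟨(hD D hp).1, (Finset.card_le_univ D).trans hd, (hD D hp).2⟩)
  exact ⟨⟨g.trans f, fun {a b} => (gadj a (Finset.mem_univ a) b).symm⟩⟩

end Pieces

/-! ### Sides of a node in a tree -/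

section TreeSeparation

variable {N : Type*} {T : SimpleGraph N}

/-- `i` and `j` lie in the same component of `T - t` (or both are equal to `t`). -/
def SameSide (T : SimpleGraph N) (t i j : N) : Prop := (restr T {t}ᶜ).Reachable i j

theorem SameSide.symm {t i j : N} (h : SameSide T t i j) : SameSide T t j i :=
  SimpleGraph.Reachable.symm h

theorem SameSide.trans {t i j l : N} (h : SameSide T t i j) (h' : SameSide T t j l) :
    SameSide T t i l :=
  SimpleGraph.Reachable.trans h h'

theorem SameSide.eq {t j : N} (h : SameSide T t j t) : j = t := by
  refine reachable_induction (G := restr T {t}ᶜ) (P := fun j => j = t) rfl ?_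
    (SimpleGraph.Reachable.symm h)
  rintro a b - hab rfl
  exact absurd rfl hab.2.1

theorem reachable_restr_of_support {U : Set N} {i j : N} (p : T.Walk i j)
    (h : ∀ l ∈ p.support, l ∈ U) : (restr T U).Reachable i j := by
  induction p with
  | nil => exact SimpleGraph.Reachable.refl _
  | @cons u v w huv p ih =>
    have hadj : (restr T U).Adj u v := ⟨huv, h u (by simp), h v (by simp)⟩
    exact hadj.reachable.trans (ih fun l hl => h l (by simp [hl]))

/-- Otherwise `a` and `b` would be joined through `j` without the edge between them, which is a
bridge. -/
theorem not_sameSide_of_adj (hT : T.IsAcyclic) {a b j : N} (hab : T.Adj a b)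
    (h1 : SameSide T a j b) (h2 : SameSide T b j a) : False := by
  have hbridge := SimpleGraph.isAcyclic_iff_forall_adj_isBridge.1 hT hab
  rw [SimpleGraph.isBridge_iff] at hbridge
  refine hbridge ((h2.mono fun x y hxy => ?_).symm.trans (h1.mono fun x y hxy => ?_))
  · have h1 := hxy.2.1
    have h2 := hxy.2.2
    simp only [Set.mem_compl_iff, Set.mem_singleton_iff] at h1 h2
    simp [hxy.1, h1, h2]
  · have h1 := hxy.2.1
    have h2 := hxy.2.2
    simp only [Set.mem_compl_iff, Set.mem_singleton_iff] at h1 h2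
    simp [hxy.1, h1, h2]

theorem exists_adj_sameSide (hT : T.Connected) {t j : N} (h : j ≠ t) :
    ∃ u, T.Adj t u ∧ SameSide T t u j := by
  obtain ⟨p, hp⟩ := (hT.preconnected t j).exists_isPath
  match p, hp with
  | .nil, _ => exact absurd rfl h
  | .cons htu p, hp =>
    rw [SimpleGraph.Walk.cons_isPath_iff] at hp
    exact ⟨_, htu, reachable_restr_of_support p fun l hl hlt => hp.2 (by
      rw [Set.mem_singleton_iff] at hlt
      rwa [← hlt])⟩

/-- The vertices of a path on either side of `p.getVert i` stay together. -/
theorem sameSide_getVert {i j : N} {p : T.Walk i j} (hp : p.IsPath) {l m n : ℕ} (hlm : l ≤ m)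
    (hm : m ≤ p.length) (hn : n ≤ p.length) (h : n < l ∨ m < n) :
    SameSide T (p.getVert n) (p.getVert l) (p.getVert m) := by
  induction m, hlm using Nat.le_induction with
  | base => exact SimpleGraph.Reachable.refl _
  | succ m hlm ih =>
    have ne : ∀ r, r ≤ p.length → r ≠ n → p.getVert r ≠ p.getVert n := fun r hr hrn h =>
      hrn (hp.getVert_injOn hr hn h)
    refine (ih (by omega) (by omega)).trans (SimpleGraph.Adj.reachable
      ⟨p.adj_getVert_succ (by omega), ne m (by omega) (by omega), ne _ hm (by omega)⟩)

theorem not_sameSide_of_isPath (hT : T.IsAcyclic) {i j : N} {p : T.Walk i j} (hp : p.IsPath)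
    (hij : i ≠ j) {n : ℕ} (hn : n ≤ p.length) : ¬ SameSide T (p.getVert n) i j := by
  intro h
  rcases Nat.eq_zero_or_pos n with rfl | hpos
  · rw [SimpleGraph.Walk.getVert_zero] at h
    exact hij h.symm.eq.symm
  obtain ⟨n, rfl⟩ := Nat.exists_eq_succ_of_ne_zero hpos.ne'
  have h1 := sameSide_getVert hp (l := 0) (m := n) (n := n + 1) (by omega) (by omega) hn
    (by omega)
  have h2 := sameSide_getVert hp (l := n + 1) (m := p.length) (n := n) (by omega) le_rfl
    (by omega) (by omega)
  rw [SimpleGraph.Walk.getVert_zero] at h1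
  rw [SimpleGraph.Walk.getVert_length] at h2
  exact not_sameSide_of_adj hT (p.adj_getVert_succ (by omega)) h2.symm (h.symm.trans h1)

end TreeSeparation

/-! ### Separating bags and the recursion on size -/

section Separators

variable {V : Type u} [DecidableEq V] [Fintype V] {G : SimpleGraph V} (T : TreeDecomposition G)

set_option linter.unusedSectionVars false

namespace TreeDecomposition

theorem sameSide_of_mem {x : V} {i j t : T.Node} (hi : x ∈ T.bag i) (hj : x ∈ T.bag j)
    (ht : x ∉ T.bag t) : SameSide T.tree t i j := by
  obtain ⟨p, hp⟩ := (T.isTree.connected.preconnected i j).exists_isPath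
  refine reachable_restr_of_support p fun l hl hlt => ht ?_
  rw [Set.mem_singleton_iff] at hlt
  rw [← hlt]
  exact T.inter_subset i j l p hp hl x hi hj

theorem sameSide_of_adj {x y : V} (hxy : G.Adj x y) {i j t : T.Node} (hi : x ∈ T.bag i)
    (hj : y ∈ T.bag j) (hx : x ∉ T.bag t) (hy : y ∉ T.bag t) : SameSide T.tree t i j := by
  obtain ⟨l, hxl, hyl⟩ := T.edge_covered x y hxy
  exact (T.sameSide_of_mem hi hxl hx).trans (T.sameSide_of_mem hyl hj hy)

theorem sameSide_of_isConn {D : Finset V} (hD : IsConn G D) {t : T.Node}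
    (ht : ∀ x ∈ D, x ∉ T.bag t) {x y : V} (hx : x ∈ D) (hy : y ∈ D) {i j : T.Node}
    (hi : x ∈ T.bag i) (hj : y ∈ T.bag j) : SameSide T.tree t i j := by
  refine reachable_induction (G := restr G (D : Set V))
    (P := fun y => ∀ j, y ∈ T.bag j → SameSide T.tree t i j)
    (fun j hj => T.sameSide_of_mem hi hj (ht x hx)) ?_ (hD x hx y hy) j hj
  intro a b _ hab ih j hj
  obtain ⟨l, hal⟩ := T.vertex_covered a
  exact (ih l hal).trans (T.sameSide_of_adj hab.1 hal hj (ht a hab.2.1) (ht b hab.2.2))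

variable {T}

theorem _root_.IsPiece.notMem_bag {C D : Finset V} {t : T.Node} (h : IsPiece G (C \ T.bag t) D) :
    ∀ x ∈ D, x ∉ T.bag t := fun _ hx => (Finset.mem_sdiff.1 (h.subset hx)).2

theorem _root_.IsPiece.subset_left {C D R : Finset V} (h : IsPiece G (C \ R) D) : D ⊆ C :=
  h.subset.trans Finset.sdiff_subset

theorem exists_mem_both {C D D' : Finset V} (hD : D ⊆ C) (hD' : D' ⊆ C)
    (h : C.card < 2 * D.card) (h' : C.card < 2 * D'.card) : ∃ x, x ∈ D ∧ x ∈ D' := by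
  by_contra! hc
  have := Finset.card_union_of_disjoint (Finset.disjoint_left.2 hc)
  have := Finset.card_le_card (Finset.union_subset hD hD')
  omega

/-- Large pieces beyond both ends of an edge of the tree cannot point at each other. -/
theorem not_big_of_adj {C D D' : Finset V} {t t' : T.Node} (hadj : T.tree.Adj t t')
    (hD : IsPiece G (C \ T.bag t) D) (hD' : IsPiece G (C \ T.bag t') D')
    (h : C.card < 2 * D.card) (h' : C.card < 2 * D'.card) {x x' : V} {i i' : T.Node}
    (hx : x ∈ D) (hxi : x ∈ T.bag i) (hi : SameSide T.tree t i t')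
    (hx' : x' ∈ D') (hxi' : x' ∈ T.bag i') (hi' : SameSide T.tree t' i' t) : False := by
  obtain ⟨y, hy, hy'⟩ := exists_mem_both hD.subset_left hD'.subset_left h h'
  obtain ⟨j, hj⟩ := T.vertex_covered y
  exact not_sameSide_of_adj T.isTree.isAcyclic hadj
    ((T.sameSide_of_isConn hD.conn hD.notMem_bag hy hx hj hxi).trans hi)
    ((T.sameSide_of_isConn hD'.conn hD'.notMem_bag hy' hx' hj hxi').trans hi')

variable (T)

/-- Some bag splits `C` into pieces of at most half the size. -/
theorem exists_balanced_bag (C : Finset V) :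
    ∃ t, ∀ D, IsPiece G (C \ T.bag t) D → 2 * D.card ≤ C.card := by
  classical
  by_contra! hc
  choose D hD hbig using hc
  have hnext : ∀ t, ∃ u, T.tree.Adj t u ∧
      ∃ x ∈ D t, ∃ i, x ∈ T.bag i ∧ SameSide T.tree t i u := by
    intro t
    obtain ⟨x, hx⟩ := (hD t).nonempty
    obtain ⟨i, hi⟩ := T.vertex_covered x
    have hit : i ≠ t := by
      rintro rfl
      exact (hD i).notMem_bag x hx hi
    obtain ⟨u, hu, hui⟩ := exists_adj_sameSide T.isTree.connected hit
    exact ⟨u, hu, x, hx, i, hi, hui.symm⟩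
  choose next hadj x hx i hi hside using hnext
  -- Each node points along an edge towards its large piece. Two nodes choosing the same edge would
  -- point at each other, so there are at least as many edges as nodes, which is impossible in a
  -- tree.
  have hinj : Function.Injective fun t =>
      (⟨s(t, next t), by simpa using hadj t⟩ : T.tree.edgeFinset) := by
    intro t t' h
    have h : s(t, next t) = s(t', next t') := congrArg Subtype.val h
    rcases Sym2.eq_iff.1 h with ⟨h, -⟩ | ⟨h1, h2⟩
    · exact h
    · exfalso
      refine not_big_of_adj (h2 ▸ hadj t) (hD t) (hD t') (hbig t) (hbig t') (hx t) (hi t)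
        (h2 ▸ hside t) (hx t') (hi t') (h1.symm ▸ hside t')
  have h1 := Fintype.card_le_of_injective _ hinj
  have h2 := T.isTree.card_edgeFinset
  rw [Fintype.card_coe] at h1
  omega

/-- Between two nodes of the tree there is a bag such that no large piece of `C` lies towards
either of them. -/
theorem exists_separating_bag (C : Finset V) {a b : T.Node} (hab : a ≠ b) :
    ∃ t, ¬ SameSide T.tree t a b ∧ ∀ D, IsPiece G (C \ T.bag t) D → C.card < 2 * D.card →
      ∀ x ∈ D, ∀ i, x ∈ T.bag i → ¬ SameSide T.tree t i a ∧ ¬ SameSide T.tree t i b := by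
  classical
  obtain ⟨p, hp⟩ := (T.isTree.connected.preconnected a b).exists_isPath
  -- `P n`: at the `n`-th node of the path some large piece lies towards `b`. At the first failure,
  -- a large piece towards `a` would face the one found at the preceding node.
  let P : ℕ → Prop := fun n => ∃ D, IsPiece G (C \ T.bag (p.getVert n)) D ∧
    C.card < 2 * D.card ∧ ∃ x ∈ D, ∃ i, x ∈ T.bag i ∧ SameSide T.tree (p.getVert n) i b
  have hlast : ¬ P p.length := by
    rintro ⟨D, hD, -, x, hx, i, hi, hib⟩
    have := hD.notMem_bag x hx
    rw [p.getVert_length] at hib this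
    rw [← hib.eq] at this
    exact this hi
  have hex : ∃ n, ¬ P n := ⟨_, hlast⟩
  have hle : Nat.find hex ≤ p.length := Nat.find_min' hex hlast
  refine ⟨p.getVert (Nat.find hex), not_sameSide_of_isPath T.isTree.isAcyclic hp hab hle,
    fun D hD hbig x hx i hi => ⟨fun hia => ?_, fun hib =>
      Nat.find_spec hex ⟨D, hD, hbig, x, hx, i, hi, hib⟩⟩⟩
  rcases Nat.eq_zero_or_pos (Nat.find hex) with h0 | hpos
  · have := hD.notMem_bag x hx
    rw [h0, p.getVert_zero] at hia this
    rw [← hia.eq] at this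
    exact this hi
  · obtain ⟨n, hn⟩ := Nat.exists_eq_succ_of_ne_zero hpos.ne'
    rw [hn] at hD hia hle
    obtain ⟨D', hD', hbig', x', hx', i', hi', hib⟩ := not_not.1
      (Nat.find_min hex (show n < Nat.find hex by omega))
    have h1 := sameSide_getVert hp (l := 0) (m := n) (n := n + 1) (by omega) (by omega) hle
      (by omega)
    have h2 := sameSide_getVert hp (l := n + 1) (m := p.length) (n := n) (by omega) le_rfl
      (by omega) (by omega)
    rw [p.getVert_zero] at h1
    rw [p.getVert_length] at h2
    exact not_big_of_adj (p.adj_getVert_succ (by omega)) hD' hD hbig' hbig hx' hi'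
      (hib.trans h2.symm) hx hi (hia.trans h1)

end TreeDecomposition

theorem IsPiece.nb_subset {C D R : Finset V} (h : IsPiece G (C \ R) D) {v : V}
    (hv : v ∈ nb G D) (hvR : v ∉ R) : v ∈ nb G C := by
  obtain ⟨hvD, c, hc, hcv⟩ := mem_nb.1 hv
  refine mem_nb.2 ⟨fun hvC => hvD (h.closed c hc v (Finset.mem_sdiff.2 ⟨hvC, hvR⟩) hcv), c,
    h.subset_left hc, hcv⟩

variable {T}

theorem IsPiece.sameSide_of_mem_nb {C D : Finset V} {t : T.Node}
    (h : IsPiece G (C \ T.bag t) D) {v : V} (hv : v ∈ nb G D) (hvt : v ∉ T.bag t) {a : T.Node}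
    (hva : v ∈ T.bag a) {x : V} (hx : x ∈ D) {i : T.Node} (hi : x ∈ T.bag i) :
    SameSide T.tree t i a := by
  obtain ⟨-, c, hc, hcv⟩ := mem_nb.1 hv
  obtain ⟨j, hj⟩ := T.vertex_covered c
  exact (T.sameSide_of_isConn h.conn h.notMem_bag hx hc hi hj).trans
    (T.sameSide_of_adj hcv hj hva (h.notMem_bag c hc) hvt)

/-- A connected set that avoids `R` is its own piece. -/
theorem IsConn.isPiece {C R : Finset V} (hC : IsConn G C) (hne : C.Nonempty)
    (hR : ¬ ∃ z ∈ C, z ∈ R) : IsPiece G (C \ R) C where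
  nonempty := hne
  subset := fun x hx => Finset.mem_sdiff.2 ⟨hx, fun h => hR ⟨x, hx, h⟩⟩
  conn := hC
  closed := fun _ _ _ hb _ => (Finset.mem_sdiff.1 hb).1

section Recursion

variable {k : ℕ}

/-- Two bags give at most `2 * k + 2` border vertices, which is enough only for positive `k`. For `k
= 0` there are no edges, so the border is empty. -/
theorem card_nb_add_three_le (hk : ∀ i, (T.bag i).card ≤ k + 1) {D : Finset V} {a b : T.Node}
    (h : nb G D ⊆ T.bag a ∪ T.bag b) : (nb G D).card + 3 ≤ 4 * k + 4 := by
  rcases Nat.eq_zero_or_pos k with rfl | hpos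
  · have : nb G D = ∅ := by
      refine Finset.eq_empty_of_forall_notMem fun v hv => ?_
      obtain ⟨-, c, -, hcv⟩ := mem_nb.1 hv
      obtain ⟨i, hci, hvi⟩ := T.edge_covered c v hcv
      exact hcv.ne (Finset.card_le_one.1 (hk i) c hci v hvi)
    simp [this]
  · have h1 := Finset.card_le_card h
    have h2 := Finset.card_union_le (T.bag a) (T.bag b)
    have h3 := hk a
    have h4 := hk b
    omega

/-- Border and separator occupy at most `3 * (k + 1)` pebbles, fewer than `4 * k + 4`, and pebbling
the trace of one bag costs at most `k + 1` rounds. -/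
theorem exists_good_of_bag (hk : ∀ i, (T.bag i).card ≤ k + 1) {d : ℕ} {C : Finset V}
    (hC : IsConn G C) {a b t : T.Node} (hnb : nb G C ⊆ T.bag a ∪ T.bag b) (hd : C.card ≤ 2 ^ d)
    (ht : ∃ z ∈ C, z ∈ T.bag t)
    (hD : ∀ D, IsPiece G (C \ T.bag t) D →
      ∃ a b, nb G D ⊆ T.bag a ∪ T.bag b ∧ ∃ z ∈ D, Good (4 * k + 4) d G D z) :
    ∃ z ∈ C, Good (4 * k + 4) (d + (k + 1)) G C z := by
  obtain ⟨z, hzC, hzt⟩ := ht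
  have hR : (C ∩ T.bag t).card ≤ k + 1 :=
    (Finset.card_le_card Finset.inter_subset_right).trans (hk t)
  have hnb' : (nb G C).card ≤ (k + 1) + (k + 1) :=
    (Finset.card_le_card hnb).trans ((Finset.card_union_le _ _).trans (add_le_add (hk a) (hk b)))
  refine ⟨z, hzC, Good.of_le (Good.step hC (Finset.mem_inter.2 ⟨hzC, hzt⟩)
    Finset.inter_subset_left (by omega) (card_nb_add_three_le hk hnb) hd fun D hp => ?_)
    (Nat.add_le_add_left hR d)⟩
  rw [Finset.sdiff_inter_self_left] at hp
  obtain ⟨a, b, hab, hgood⟩ := hD D hp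
  exact ⟨card_nb_add_three_le hk hab, hgood⟩

theorem exists_good_of_one_border (hk : ∀ i, (T.bag i).card ≤ k + 1) {j : ℕ}
    (ih : ∀ (C : Finset V) (a b : T.Node), IsConn G C → C.Nonempty → C.card < 2 ^ j →
      nb G C ⊆ T.bag a ∪ T.bag b → ∃ z ∈ C, Good (4 * k + 4) (2 * (k + 1) * j + 1) G C z)
    {C : Finset V} {a : T.Node} (hC : IsConn G C) (hne : C.Nonempty) (hcard : C.card < 2 ^ (j + 1))
    (hnb : nb G C ⊆ T.bag a) :
    ∃ z ∈ C, Good (4 * k + 4) (2 * (k + 1) * j + 1 + (k + 1)) G C z := by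
  obtain ⟨t, ht⟩ := T.exists_balanced_bag C
  refine exists_good_of_bag hk hC (a := a) (b := a) (t := t) (by simpa using hnb)
    -- The summand `1` in the depth makes it at least `j + 1`, also for `j = 0`.
    (hcard.le.trans (Nat.pow_le_pow_right (by norm_num) (by nlinarith))) ?_ fun D hp => ?_
  · by_contra hc
    have := ht C (hC.isPiece hne hc)
    have := hne.card_pos
    omega
  · have hD : nb G D ⊆ T.bag a ∪ T.bag t := fun v hv => by
      by_cases hvt : v ∈ T.bag t
      · exact Finset.mem_union_right _ hvt
      · exact Finset.mem_union_left _ (hnb (hp.nb_subset hv hvt))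
    have := ht D hp
    rw [pow_succ] at hcard
    exact ⟨a, t, hD, ih D a t hp.conn hp.nonempty (by omega) hD⟩

/-- A separating bag costs `k + 1` rounds. A piece of at most half the size goes to the induction
hypothesis; a larger one has its border in a single bag and takes another `k + 1` rounds to be
halved. -/
theorem exists_good (hk : ∀ i, (T.bag i).card ≤ k + 1) (j : ℕ) (C : Finset V) (a b : T.Node)
    (hC : IsConn G C) (hne : C.Nonempty) (hcard : C.card < 2 ^ j)
    (hnb : nb G C ⊆ T.bag a ∪ T.bag b) :
    ∃ z ∈ C, Good (4 * k + 4) (2 * (k + 1) * j + 1) G C z := by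
  induction j generalizing C a b with
  | zero =>
    have := hne.card_pos
    exact absurd (Nat.lt_one_iff.1 hcard) this.ne'
  | succ j ih =>
    have hdepth : 2 * (k + 1) * (j + 1) + 1 = 2 * (k + 1) * j + 1 + (k + 1) + (k + 1) := by ring
    have one : ∀ (C : Finset V) (a : T.Node), IsConn G C → C.Nonempty → C.card < 2 ^ (j + 1) →
        nb G C ⊆ T.bag a →
        ∃ z ∈ C, Good (4 * k + 4) (2 * (k + 1) * j + 1 + (k + 1)) G C z :=
      fun C a hC hne hcard hnb => exists_good_of_one_border hk ih hC hne hcard hnb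
    have one' : ∀ (a : T.Node), nb G C ⊆ T.bag a →
        ∃ z ∈ C, Good (4 * k + 4) (2 * (k + 1) * (j + 1) + 1) G C z := fun a ha => by
      obtain ⟨z, hz, hgood⟩ := one C a hC hne hcard ha
      exact ⟨z, hz, hgood.of_le (by omega)⟩
    by_cases hab : a = b
    · subst hab
      exact one' a (by simpa using hnb)
    obtain ⟨t, hsep, hbig⟩ := T.exists_separating_bag C hab
    by_cases ht : ∃ z ∈ C, z ∈ T.bag t
    · rw [hdepth]
      refine exists_good_of_bag hk hC hnb
        (hcard.le.trans (Nat.pow_le_pow_right (by norm_num) (by nlinarith))) ht fun D hp => ?_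
      obtain ⟨x, hx⟩ := hp.nonempty
      obtain ⟨i, hi⟩ := T.vertex_covered x
      by_cases hsmall : 2 * D.card ≤ C.card
      -- Border vertices outside `T.bag t` all lie on the side of `D`. As `t` separates `a` from
      -- `b`, they cannot come from both bags.
      · have hborder : ∃ c, nb G D ⊆ T.bag t ∪ T.bag c := by
          by_cases hex : ∃ v ∈ nb G D, v ∉ T.bag t ∧ v ∈ T.bag a
          · obtain ⟨v, hv, hvt, hva⟩ := hex
            refine ⟨a, fun w hw => ?_⟩
            by_cases hwt : w ∈ T.bag t
            · exact Finset.mem_union_left _ hwt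
            rcases Finset.mem_union.1 (hnb (hp.nb_subset hw hwt)) with hwa | hwb
            · exact Finset.mem_union_right _ hwa
            · exact absurd ((hp.sameSide_of_mem_nb hv hvt hva hx hi).symm.trans
                (hp.sameSide_of_mem_nb hw hwt hwb hx hi)) hsep
          · push Not at hex
            refine ⟨b, fun w hw => ?_⟩
            by_cases hwt : w ∈ T.bag t
            · exact Finset.mem_union_left _ hwt
            · exact Finset.mem_union_right _ ((Finset.mem_union.1
                (hnb (hp.nb_subset hw hwt))).resolve_left (hex w hw hwt))
        obtain ⟨c, hc⟩ := hborder
        rw [pow_succ] at hcard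
        obtain ⟨z, hz, hgood⟩ := ih D t c hp.conn hp.nonempty (by omega) hc
        exact ⟨t, c, hc, z, hz, hgood.of_le (by omega)⟩
      · have hDt : nb G D ⊆ T.bag t := fun v hv => by
          by_contra hvt
          obtain ⟨h1, h2⟩ := hbig D hp (by omega) x hx i hi
          rcases Finset.mem_union.1 (hnb (hp.nb_subset hv hvt)) with h | h
          · exact h1 (hp.sameSide_of_mem_nb hv hvt h hx hi)
          · exact h2 (hp.sameSide_of_mem_nb hv hvt h hx hi)
        exact ⟨t, t, by simpa using hDt, one D t hp.conn hp.nonempty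
          ((Finset.card_le_card hp.subset_left).trans_lt hcard) hDt⟩
    -- If the bag misses `C`, then `C` is itself a large piece, so its whole border lies in that
    -- bag.
    · have hp := hC.isPiece hne ht
      refine one' t fun v hv => ?_
      by_contra hvt
      obtain ⟨x, hx⟩ := hne
      obtain ⟨i, hi⟩ := T.vertex_covered x
      obtain ⟨h1, h2⟩ := hbig C hp (by have := hp.nonempty.card_pos; omega) x hx i hi
      rcases Finset.mem_union.1 (hnb hv) with h | h
      · exact h1 (hp.sameSide_of_mem_nb hv hvt h hx hi)
      · exact h2 (hp.sameSide_of_mem_nb hv hvt h hx hi)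

end Recursion

end Separators

/-! ### Assembling the bound -/

theorem exists_treeDecomposition_card_bag_le {V : Type u} [Fintype V] {G : SimpleGraph V} {k : ℕ}
    (hk : treewidth G = k) : ∃ T : TreeDecomposition G, ∀ i, (T.bag i).card ≤ k + 1 := by
  have := nonempty_treeDecomposition G
  obtain ⟨T, hT⟩ := Nat.sInf_mem (Set.range_nonempty fun T : TreeDecomposition G => T.width)
  have hT : T.width = treewidth G := hT
  refine ⟨T, fun i => ?_⟩
  have h1 := Finset.le_sup (f := fun i => (T.bag i).card) (Finset.mem_univ i)
  rw [hk, TreeDecomposition.width] at hT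
  have h1 : (T.bag i).card ≤ Finset.univ.sup fun i => (T.bag i).card := h1
  omega

theorem theorem6p1 {V : Type u} [Fintype V] [Nonempty V] (G : SimpleGraph V) (n k : ℕ)
    (hn : Fintype.card V = n) (hk : treewidth G = k) :
    ∃ φ : CountingFormula (4 * k + 4),
      CountingFormula.Defines.{u, v} φ G ∧
      (φ.quantifierDepth : ℝ) < 2 * ((k : ℝ) + 1) * Real.logb 2 (n : ℝ) + 8 * (k : ℝ) + 9 := by
  classical
  obtain ⟨T, hT⟩ := exists_treeDecomposition_card_bag_le hk
  have hcard : n < 2 ^ (Nat.log 2 n + 1) := Nat.lt_pow_succ_log_self (by norm_num) n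
  -- Components of `G` have empty border, so a balanced bag (`k + 1` rounds) comes first, and one
  -- opening round supplies the bijection. The excess over the logarithmic term is `k + 3`, below `8
  -- * k + 9`.
  obtain ⟨φ, hφ, hdepth⟩ := CountingFormula.exists_defines_of_sim.{u, v} (s := 4 * k + 4)
    (G := G) (d := 2 * (k + 1) * Nat.log 2 n + 1 + (k + 1) + 1) (by omega) (by omega) fun H hH => by
      refine nonempty_iso_of_sim (by omega) hH ?_ fun D hp => ?_
      · rw [hn]
        exact hcard.le.trans (Nat.pow_le_pow_right (by norm_num) (by nlinarith))
      · obtain ⟨a⟩ := T.isTree.connected.nonempty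
        have hnb : nb G D = ∅ := Finset.eq_empty_of_forall_notMem fun v hv => by
          obtain ⟨hvD, c, hc, hcv⟩ := mem_nb.1 hv
          exact hvD (hp.closed c hc v (Finset.mem_univ v) hcv)
        have hDn : D.card < 2 ^ (Nat.log 2 n + 1) :=
          (hn ▸ Finset.card_le_univ D).trans_lt hcard
        exact ⟨card_nb_add_three_le (T := T) hT (a := a) (b := a) (by simp [hnb]),
          exists_good_of_one_border (a := a) hT (exists_good hT _) hp.conn hp.nonempty hDn
            (by simp [hnb])⟩
  refine ⟨φ, hφ, ?_⟩
  have hlog : (Nat.log 2 n : ℝ) ≤ Real.logb 2 n := by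
    exact_mod_cast Real.natLog_le_logb n 2
  have hd : (φ.quantifierDepth : ℝ) ≤ 2 * (k + 1) * Nat.log 2 n + 1 + (k + 1) + 1 := by
    exact_mod_cast hdepth
  have hk0 : (0 : ℝ) ≤ k := Nat.cast_nonneg k
  have := mul_le_mul_of_nonneg_left hlog (show (0 : ℝ) ≤ 2 * (k + 1) by positivity)
  linarith
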